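/- Let $m,n\ge 0$ be integers, let $\mathfrak G_{2n}$ be the real Grassmann algebra with generators $\grave x_1,\dots,\grave x_{2n}$, and let superfunctions be functions $F=\sum_{A}F_A(\underline x)\,\grave x_A$ on $\mathbb R^m$ with values in $\mathfrak G_{2n}$, with body $F_0=F_\emptyset$ and nilpotent part $\mathbf F=F-F_0$. Let $e_1,\dots,e_m,\grave e_1,\dots,\grave e_{2n}$ generate the algebra $\mathcal C_{m,2n}$ with $e_je_k+e_ke_j=-2\delta_{jk}$, $e_j\grave e_k+\grave e_ke_j=0$, $\grave e_j\grave e_k-\grave e_k\grave e_j=g_{jk}$, where $g_{2j-1,2k}=-g_{2k,2j-1}=\delta_{jk}$, $g_{2j,2k}=g_{2j-1,2k-1}=0$, and let $$\partial_{\mathbf x}[g]=2\sum_{j=1}^n\bigl(\grave e_{2j}\,\partial_{\grave x_{2j-1}}g-\grave e_{2j-1}\,\partial_{\grave x_{2j}}g\bigr)-\sum_{j=1}^m e_j\,\partial_{x_j}g .$$ For an even superfunction $a=a_0+\mathbf a$ and $p\in\mathbb R$, put, where $a_0>0$, $a^p=\sum_{j=0}^n\frac{\mathbf a^j}{j!}\,p(p-1)\cdots(p-j+1)\,a_0^{p-j}$,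 and for a supervector $v$ put $|v|=(-v^2)^{1/2}$. For an even smooth superfunction $g$ with $\nabla g_0\ne0$ on $g_0^{-1}(0)$ put $\delta(g)=\sum_{j=0}^n\frac{\mathbf g^j}{j!}\,\delta^{(j)}(g_0)$, where $\delta^{(j)}(g_0)$ is the pull-back of $\delta^{(j)}$ by $g_0$, that is, $\langle\delta^{(j)}(g_0),f\rangle=(-1)^j\frac{d^{j+1}}{dt^{j+1}}\big|_{t=0}\int_{\{g_0<t\}}f\,dV$ for test functions $f$. Since $\delta(g)$ is supported in $g_0^{-1}(0)$, it may be multiplied by superfunctions that are smooth near this set, such as $|\partial_{\mathbf x}[g]|$, and if $g_0^{-1}(0)$ is compact it acts on superfunctions that are of class $C^n$ near this set. Put $\int_B=\pi^{-n}\partial_{\grave x_{2n}}\cdots\partial_{\grave x_1}$ and $\int_{\mathbb R^{m|2n}}=\int_{\mathbb R^m}dV\int_B$. A superdistribution is determined by its action $F\mapsto\int_{\mathbb R^{m|2n}}\alpha F$ on $C_0^\infty(\mathbb R^m)\otimes\mathfrak G_{2n}$. **Proposition.** Let $g=g_0+\mathbf g$ and $h=h_0+\mathbf h$ be even superfunctions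 in $C^\infty(\mathbb R^m)\otimes\mathfrak G_{2n}^{(ev)}$ such that $\nabla g_0\neq0$ on $g_0^{-1}(0)$ and $h_0>0$ on $\mathbb R^m$. Then, as superdistributions, $$\text{i)}\quad \delta(hg)\,\partial_{\mathbf x}[hg]=\delta(g)\,\partial_{\mathbf x}[g],\qquad\qquad \text{ii)}\quad \delta(hg)\,\bigl|\partial_{\mathbf x}[hg]\bigr|=\delta(g)\,\bigl|\partial_{\mathbf x}[g]\bigr| .$$ Hence the surface integrals do not depend on the defining phase function: let $\varphi$ define the same surface as $g$, i.e. $\varphi$ is an even smooth superfunction with $\nabla\varphi_0\ne0$ on $\varphi_0^{-1}(0)$ and $\varphi=kg$ for some even smooth superfunction $k$ with $k_0>0$ on $\mathbb R^m$, and let $g_0^{-1}(0)$ be compact. Then $\varphi_0^{-1}(0)=g_0^{-1}(0)$, and for every superfunction $F$ of class $C^n$ on a neighbourhood of this set the integrals below are well defined and $$-\int_{\mathbb R^{m|2n}}\delta(\varphi)\,\partial_{\mathbf x}[\varphi]\,F=-\int_{\mathbb R^{m|2n}}\delta(g)\,\partial_{\mathbf x}[g]\,F,\qquad \int_{\mathbb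 R^{m|2n}}\delta(\varphi)\,\bigl|\partial_{\mathbf x}[\varphi]\bigr|\,F=\int_{\mathbb R^{m|2n}}\delta(g)\,\bigl|\partial_{\mathbf x}[g]\bigr|\,F .$$ -/

import Mathlib

open scoped ContDiff TensorProduct Topology

namespace SuperSpace

noncomputable section

/-! ### The Grassmann algebra and superfunctions -/

/-- The space `ℝ^m` of the bosonic variables. -/
abbrev Bos (m : ℕ) : Type := EuclideanSpace ℝ (Fin m)

/-- The Grassmann algebra `𝔊_{2n}`, i.e. the exterior algebra on `2n` generators. -/
abbrev Grassmann (n : ℕ) : Type := ExteriorAlgebra ℝ (Fin (2 * n) → ℝ)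

/-- Functions `F(x, x̀) = ∑_A F_A(x) x̀_A` of `m` bosonic and `2n` fermionic variables. Sums and
products are pointwise in `x`. -/
abbrev SuperFun (m n : ℕ) : Type := Bos m → Grassmann n

/-- The basis `x̀_A = x̀_{j₁} ⋯ x̀_{jₖ}`, `A = {j₁ < ⋯ < jₖ}`, of the Grassmann algebra. -/
def monomialBasis (n : ℕ) : Module.Basis (Finset (Fin (2 * n))) ℝ (Grassmann n) :=
  (Pi.basisFun ℝ (Fin (2 * n))).ExteriorAlgebra

/-- The coefficient function `F_A`. -/
def coeff {m n : ℕ} (A : Finset (Fin (2 * n))) (F : SuperFun m n) : Bos m → ℝ :=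
  fun x => (monomialBasis n).repr (F x) A

/-- `F ∈ C^∞(ℝ^m) ⊗ 𝔊_{2n}`. -/
def IsSmooth {m n : ℕ} (F : SuperFun m n) : Prop :=
  ∀ A, ContDiff ℝ ∞ (coeff A F)

/-- `F` takes its values in the even part of the Grassmann algebra. -/
def IsEven {m n : ℕ} (F : SuperFun m n) : Prop :=
  ∀ x, F x ∈ CliffordAlgebra.even (0 : QuadraticForm ℝ (Fin (2 * n) → ℝ))

/-- `F ∈ C_0^∞(ℝ^m) ⊗ 𝔊_{2n}`: the test superfunctions. -/
def IsTest {m n : ℕ} (F : SuperFun m n) : Prop :=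
  IsSmooth F ∧ HasCompactSupport F

/-- `F` is a superfunction of class `C^k` on an open neighbourhood of `S` (its values elsewhere are
irrelevant). -/
def IsCkNear {m n : ℕ} (k : ℕ) (S : Set (Bos m)) (F : SuperFun m n) : Prop :=
  ∃ U : Set (Bos m), IsOpen U ∧ S ⊆ U ∧ ∀ A, ContDiffOn ℝ k (coeff A F) U

/-- The body of an element of the Grassmann algebra. -/
def body {n : ℕ} (a : Grassmann n) : ℝ := ExteriorAlgebra.algebraMapInv a

/-- The nilpotent part of an element of the Grassmann algebra. -/
def nil {n : ℕ} (a : Grassmann n) : Grassmann n := a - algebraMap ℝ (Grassmann n) (body a)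

/-- The body `g₀ : ℝ^m → ℝ` of a superfunction. -/
def bodyFun {m n : ℕ} (g : SuperFun m n) : Bos m → ℝ := fun x => body (g x)

/-- The real surface `g₀⁻¹(0)` associated to a superfunction. -/
def zeroSet {m n : ℕ} (g : SuperFun m n) : Set (Bos m) := {x | bodyFun g x = 0}

/-- The gradient of the body `g₀` does not vanish on `g₀⁻¹(0)`. -/
def IsRegular {m n : ℕ} (g : SuperFun m n) : Prop :=
  ∀ x ∈ zeroSet g, fderiv ℝ (bodyFun g) x ≠ 0

/-! ### Derivatives and the Berezin integral -/

/-- The bosonic derivative `∂_{x_j}`, acting on the coefficients `F_A`. -/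
def bosDeriv {m n : ℕ} (j : Fin m) (F : SuperFun m n) : SuperFun m n :=
  fun x => ∑ A, lineDeriv ℝ (coeff A F) x (EuclideanSpace.single j 1) • monomialBasis n A

/-- The fermionic derivative on the Grassmann algebra: the left contraction, which satisfies
`∂_j 1 = 0` and `∂_j (x̀_k b) = δ_{jk} b - x̀_k ∂_j b`. -/
def grDeriv {n : ℕ} (j : Fin (2 * n)) : Grassmann n →ₗ[ℝ] Grassmann n :=
  CliffordAlgebra.contractLeft (LinearMap.proj j : (Fin (2 * n) → ℝ) →ₗ[ℝ] ℝ)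

/-- The fermionic derivative `∂_{x̀_j}` of a superfunction. -/
def ferDeriv {m n : ℕ} (j : Fin (2 * n)) (F : SuperFun m n) : SuperFun m n :=
  fun x => grDeriv j (F x)

/-- The Berezin integral `∫_B = π^{-n} ∂_{x̀_{2n}} ⋯ ∂_{x̀_1}` (the iterated derivative is a real
number, which is read off as the body). -/
def berezin {n : ℕ} (a : Grassmann n) : ℝ :=
  (Real.pi ^ n)⁻¹ * body ((List.finRange (2 * n)).foldl (fun b j => grDeriv j b) a)

/-- The position of the fermionic variable `x̀_{2j-1}` (`j = 1, …, n`), counted from zero. -/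
def ferFst {n : ℕ} (j : Fin n) : Fin (2 * n) := ⟨2 * j, by omega⟩

/-- The position of the fermionic variable `x̀_{2j}` (`j = 1, …, n`), counted from zero. -/
def ferSnd {n : ℕ} (j : Fin n) : Fin (2 * n) := ⟨2 * j + 1, by omega⟩

/-! ### The Clifford algebra and supervectors -/

/-- Labels of the Clifford generators: `inl j` for `e_j`, `inr (inl j)` for `è_{2j-1}` and
`inr (inr j)` for `è_{2j}`. -/
abbrev GenIdx (m n : ℕ) : Type := Fin m ⊕ (Fin n ⊕ Fin n)

/-- The symplectic form: `g_{2j-1,2k} = δ_{jk} = -g_{2k,2j-1}`, all other entries are zero. -/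
def symp {n : ℕ} : Fin n ⊕ Fin n → Fin n ⊕ Fin n → ℝ
  | Sum.inl j, Sum.inr k => if j = k then 1 else 0
  | Sum.inr k, Sum.inl j => if j = k then -1 else 0
  | Sum.inl _, Sum.inl _ => 0
  | Sum.inr _, Sum.inr _ => 0

/-- The defining relations of the algebra `𝒞_{m,2n}`. -/
inductive CliffordRel (m n : ℕ) :
    FreeAlgebra ℝ (GenIdx m n) → FreeAlgebra ℝ (GenIdx m n) → Prop
  | orth (j k : Fin m) : CliffordRel m n
      (FreeAlgebra.ι ℝ (Sum.inl j) * FreeAlgebra.ι ℝ (Sum.inl k) +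
        FreeAlgebra.ι ℝ (Sum.inl k) * FreeAlgebra.ι ℝ (Sum.inl j))
      (algebraMap ℝ _ (if j = k then -2 else 0))
  | mixed (j : Fin m) (k : Fin n ⊕ Fin n) : CliffordRel m n
      (FreeAlgebra.ι ℝ (Sum.inl j) * FreeAlgebra.ι ℝ (Sum.inr k) +
        FreeAlgebra.ι ℝ (Sum.inr k) * FreeAlgebra.ι ℝ (Sum.inl j))
      0
  | sympl (j k : Fin n ⊕ Fin n) : CliffordRel m n
      (FreeAlgebra.ι ℝ (Sum.inr j) * FreeAlgebra.ι ℝ (Sum.inr k) -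
        FreeAlgebra.ι ℝ (Sum.inr k) * FreeAlgebra.ι ℝ (Sum.inr j))
      (algebraMap ℝ _ (symp j k))

/-- The algebra `𝒞_{m,2n}` generated by `e_1, …, e_m, è_1, …, è_{2n}`. -/
abbrev SuperClifford (m n : ℕ) : Type := RingQuot (CliffordRel m n)

/-- The Clifford generators. -/
def gen {m n : ℕ} (i : GenIdx m n) : SuperClifford m n :=
  RingQuot.mkAlgHom ℝ (CliffordRel m n) (FreeAlgebra.ι ℝ i)

/-- The element `∑_i v_i e_i` of `𝔊_{2n} ⊗ 𝒞_{m,2n}` with components `v_i ∈ 𝔊_{2n}`. -/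
def toClifford {m n : ℕ} (v : GenIdx m n → Grassmann n) : Grassmann n ⊗[ℝ] SuperClifford m n :=
  ∑ i, v i ⊗ₜ[ℝ] gen i

/-- The components of the super gradient
`∂_𝐱[g] = 2 ∑_j (è_{2j} ∂_{x̀_{2j-1}} g - è_{2j-1} ∂_{x̀_{2j}} g) - ∑_j e_j ∂_{x_j} g`
with respect to the Clifford generators. -/
def superGrad {m n : ℕ} (g : SuperFun m n) : GenIdx m n → SuperFun m n
  | Sum.inl j => -bosDeriv j g
  | Sum.inr (Sum.inl j) => (-2 : ℝ) • ferDeriv (ferSnd j) g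
  | Sum.inr (Sum.inr j) => (2 : ℝ) • ferDeriv (ferFst j) g

/-- The element `-v²` of `𝔊_{2n}`, for a supervector `v` with even components along the `e_j` and
odd components along the `è_j`; see `toClifford_mul_self`. -/
def negSq {m n : ℕ} (v : GenIdx m n → Grassmann n) : Grassmann n :=
  ∑ j, v (Sum.inl j) * v (Sum.inl j) -
    ∑ j, v (Sum.inr (Sum.inl j)) * v (Sum.inr (Sum.inr j))

/-- `a^p = ∑_{j ≤ n} (𝐚^j / j!) (-1)^j (-p)_j a₀^{p-j}` for an even element `a = a₀ + 𝐚` with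
`a₀ > 0`, where `(q)_j` is the rising Pochhammer symbol. -/
def grPow {n : ℕ} (a : Grassmann n) (p : ℝ) : Grassmann n :=
  ∑ j ∈ Finset.range (n + 1),
    ((-1) ^ j * (ascPochhammer ℝ j).eval (-p) * body a ^ (p - j) / (j.factorial : ℝ)) • nil a ^ j

/-- The absolute value `|v| = (-v²)^{1/2}` of a supervector. -/
def absVec {m n : ℕ} (v : GenIdx m n → Grassmann n) : Grassmann n := grPow (negSq v) (1 / 2)

/-- The absolute value `|∂_𝐱[g]|`. If `g` is regular, this is a smooth superfunction on a
neighbourhood of `g₀⁻¹(0)`, and only its values near `g₀⁻¹(0)` enter in `δ(g) |∂_𝐱[g]|`. -/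
def absGrad {m n : ℕ} (g : SuperFun m n) : SuperFun m n :=
  fun x => absVec (fun i => superGrad g i x)

/-! ### The Dirac distribution -/

/-- The ball-type neighbourhood of radius `ε` of the part of `g₀⁻¹(0)` on which `f` lives. -/
def nearZero {m : ℕ} (g₀ f : Bos m → ℝ) (ε : ℝ) : Set (Bos m) :=
  Metric.thickening ε ({x | g₀ x = 0} ∩ tsupport f)

/-- The function `t ↦ ∫_{g₀ < t} f dV`, the integral being restricted to a neighbourhood of
`g₀⁻¹(0) ∩ supp f`. For small `ε` and small `t` its derivative is
`t ↦ ∫_{g₀ = t} f / |∇g₀| dS`. -/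
def sublevelIntegral {m : ℕ} (g₀ f : Bos m → ℝ) (ε t : ℝ) : ℝ :=
  ∫ x in nearZero g₀ f ε ∩ {x | g₀ x < t}, f x

/-- The number `c` is the value `⟨δ^{(j)}(g₀), f⟩` of the composed distribution `δ^{(j)}(g₀)`,
that is, of the pull-back of `δ^{(j)}` by `g₀`: the adjoint of integration over the fibres,
`⟨u(g₀), f⟩ = ⟨u, d/dt ∫_{g₀ < t} f dV⟩`, taken at `u = δ^{(j)}`. Since `δ^{(j)}(g₀)` is supported
in `g₀⁻¹(0)`, the function `f` has to be regular only near this set; the integral is therefore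
localised to the `ε`-neighbourhoods of `g₀⁻¹(0) ∩ supp f`, and the value has to be the same for all
small `ε`. The differentiability that the formula needs is part of the definition. -/
def HasDeltaPairing {m : ℕ} (g₀ : Bos m → ℝ) (j : ℕ) (f : Bos m → ℝ) (c : ℝ) : Prop :=
  ∀ᶠ ε in 𝓝[>] (0 : ℝ),
    MeasureTheory.IntegrableOn f (nearZero g₀ f ε) ∧
    ContDiffAt ℝ (j + 1) (sublevelIntegral g₀ f ε) 0 ∧
    (-1) ^ j * iteratedDeriv (j + 1) (sublevelIntegral g₀ f ε) 0 = c

/-- The value `⟨δ^{(j)}(g₀), f⟩` is well defined. -/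
def DeltaPairable {m : ℕ} (g₀ : Bos m → ℝ) (j : ℕ) (f : Bos m → ℝ) : Prop :=
  ∃ c, HasDeltaPairing g₀ j f c

/-- The value `⟨δ^{(j)}(g₀), f⟩` of the composed distribution `δ^{(j)}(g₀)`. -/
def deltaPairing {m : ℕ} (g₀ : Bos m → ℝ) (j : ℕ) (f : Bos m → ℝ) : ℝ :=
  Filter.limUnder (𝓝[>] (0 : ℝ)) fun ε =>
    (-1) ^ j * iteratedDeriv (j + 1) (sublevelIntegral g₀ f ε) 0

/-- The terms of `∫_{ℝ^{m|2n}} δ(g) P`, with `δ(g) = ∑_{j ≤ n} (𝐠^j / j!) δ^{(j)}(g₀)`: the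
function `∫_B (𝐠^j / j!) P` on `ℝ^m`, on which `δ^{(j)}(g₀)` acts. -/
def deltaTerm {m n : ℕ} (g P : SuperFun m n) (j : ℕ) : Bos m → ℝ :=
  fun x => berezin (((j.factorial : ℝ)⁻¹ • nil (g x) ^ j) * P x)

/-- `∫_{ℝ^{m|2n}} δ(g) P` is well defined. -/
def DeltaIntegrable {m n : ℕ} (g P : SuperFun m n) : Prop :=
  ∀ j ∈ Finset.range (n + 1), DeltaPairable (bodyFun g) j (deltaTerm g P j)

/-- The integral `∫_{ℝ^{m|2n}} δ(g) P`, for the superdistribution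
`δ(g) = ∑_{j ≤ n} (𝐠^j / j!) δ^{(j)}(g₀)`. For a superfunction `Q` that is smooth near `g₀⁻¹(0)`,
the superdistribution `δ(g) Q` is the functional `F ↦ ∫ δ(g) Q F` on test superfunctions. -/
def deltaIntegral {m n : ℕ} (g P : SuperFun m n) : ℝ :=
  ∑ j ∈ Finset.range (n + 1), deltaPairing (bodyFun g) j (deltaTerm g P j)

/-! ### Surface integrals -/

/-- The non-oriented surface integral `∫_{ℝ^{m|2n}} δ(g) |∂_𝐱[g]| F`. -/
def surfaceIntegral {m n : ℕ} (g F : SuperFun m n) : ℝ :=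
  deltaIntegral g (absGrad g * F)

/-- The oriented surface integral `-∫_{ℝ^{m|2n}} δ(g) ∂_𝐱[g] F`, with values in `𝒞_{m,2n}`. -/
def orientedSurfaceIntegral {m n : ℕ} (g F : SuperFun m n) : SuperClifford m n :=
  -∑ i : GenIdx m n, deltaIntegral g (superGrad g i * F) • gen i

/-- Both surface integrals of `F` over the surface defined by `g` are well defined. -/
def SurfaceIntegrable {m n : ℕ} (g F : SuperFun m n) : Prop :=
  DeltaIntegrable g (absGrad g * F) ∧ ∀ i : GenIdx m n, DeltaIntegrable g (superGrad g i * F)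

/-- The regular even smooth superfunctions `g` and `φ` define the same surface in superspace. -/
def DefineSameSurface {m n : ℕ} (g φ : SuperFun m n) : Prop :=
  IsSmooth g ∧ IsEven g ∧ IsRegular g ∧ IsSmooth φ ∧ IsEven φ ∧ IsRegular φ ∧
    ∃ h : SuperFun m n, IsSmooth h ∧ IsEven h ∧ (∀ x, 0 < bodyFun h x) ∧ φ = h * g

/-! ### Consistency of the definitions -/

theorem HasDeltaPairing.deltaPairing_eq {m : ℕ} {g₀ : Bos m → ℝ} {j : ℕ} {f : Bos m → ℝ} {c : ℝ}
    (hc : HasDeltaPairing g₀ j f c) : deltaPairing g₀ j f = c := by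
  refine Filter.Tendsto.limUnder_eq ?_
  refine tendsto_const_nhds.congr' ?_
  filter_upwards [hc] with ε hε
  exact hε.2.2.symm

/-- The Clifford form of the super gradient. -/
theorem toClifford_superGrad {m n : ℕ} (g : SuperFun m n) (x : Bos m) :
    toClifford (fun i => superGrad g i x) =
      (2 : ℝ) • ∑ j : Fin n,
        (ferDeriv (ferFst j) g x ⊗ₜ[ℝ] gen (m := m) (Sum.inr (Sum.inr j)) -
          ferDeriv (ferSnd j) g x ⊗ₜ[ℝ] gen (m := m) (Sum.inr (Sum.inl j))) -
      ∑ j : Fin m, bosDeriv j g x ⊗ₜ[ℝ] gen (n := n) (Sum.inl j) := by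
  simp only [toClifford, Fintype.sum_sum_type, superGrad, Pi.neg_apply, Pi.smul_apply,
    TensorProduct.neg_tmul, TensorProduct.smul_tmul', Finset.sum_neg_distrib,
    Finset.sum_sub_distrib, smul_sub, Finset.smul_sum, neg_smul]
  abel

theorem gen_orth {m n : ℕ} (j k : Fin m) :
    gen (n := n) (Sum.inl j) * gen (Sum.inl k) + gen (Sum.inl k) * gen (Sum.inl j) =
      algebraMap ℝ (SuperClifford m n) (if j = k then -2 else 0) := by
  have := RingQuot.mkAlgHom_rel ℝ (CliffordRel.orth (n := n) j k)
  simpa only [gen, map_add, map_mul, AlgHom.commutes] using this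

theorem gen_mixed {m n : ℕ} (j : Fin m) (k : Fin n ⊕ Fin n) :
    gen (Sum.inl j) * gen (Sum.inr k) + gen (Sum.inr k) * gen (Sum.inl j) =
      (0 : SuperClifford m n) := by
  have := RingQuot.mkAlgHom_rel ℝ (CliffordRel.mixed j k)
  simpa only [gen, map_add, map_mul, map_zero] using this

theorem gen_symp {m n : ℕ} (j k : Fin n ⊕ Fin n) :
    gen (m := m) (Sum.inr j) * gen (Sum.inr k) - gen (Sum.inr k) * gen (Sum.inr j) =
      algebraMap ℝ (SuperClifford m n) (symp j k) := by
  have := RingQuot.mkAlgHom_rel ℝ (CliffordRel.sympl (m := m) j k)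
  simpa only [gen, map_sub, map_mul, AlgHom.commutes] using this

/-- In the algebra `𝔊_{2n} ⊗ 𝒞_{m,2n}` the square of a supervector `v` is `-negSq v`. -/
theorem toClifford_mul_self {m n : ℕ} (v : GenIdx m n → Grassmann n)
    (hev : ∀ j i, v (Sum.inl j) * v i = v i * v (Sum.inl j))
    (hodd : ∀ j k, v (Sum.inr j) * v (Sum.inr k) = -(v (Sum.inr k) * v (Sum.inr j))) :
    toClifford v * toClifford v = -(negSq v ⊗ₜ[ℝ] (1 : SuperClifford m n)) := by
  have key : ∀ i k : GenIdx m n,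
      (v i * v k) ⊗ₜ[ℝ] (gen (m := m) (n := n) i * gen k) +
        (v k * v i) ⊗ₜ[ℝ] (gen (m := m) (n := n) k * gen i) =
      (match i, k with
        | Sum.inl i, Sum.inl k => (if i = k then (-2 : ℝ) else 0)
        | Sum.inr i, Sum.inr k => symp i k
        | _, _ => 0) • ((v i * v k) ⊗ₜ[ℝ] (1 : SuperClifford m n)) := by
    rintro (i | i) (k | k)
    · rw [hev k (Sum.inl i), ← TensorProduct.tmul_add, gen_orth, Algebra.algebraMap_eq_smul_one,
        TensorProduct.tmul_smul]
    · rw [← hev i (Sum.inr k), ← TensorProduct.tmul_add, gen_mixed, TensorProduct.tmul_zero,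
        zero_smul]
    · rw [hev k (Sum.inr i), ← TensorProduct.tmul_add, add_comm, gen_mixed,
        TensorProduct.tmul_zero, zero_smul]
    · rw [hodd k i, TensorProduct.neg_tmul, ← sub_eq_add_neg, ← TensorProduct.tmul_sub, gen_symp,
        Algebra.algebraMap_eq_smul_one, TensorProduct.tmul_smul]
  have hS : toClifford v * toClifford v = ∑ i, ∑ k,
      (v i * v k) ⊗ₜ[ℝ] (gen (m := m) (n := n) i * gen k) := by
    simp only [toClifford, Finset.sum_mul_sum, Algebra.TensorProduct.tmul_mul_tmul]
  have h2 : (2 : ℝ) • (toClifford v * toClifford v) =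
      (2 : ℝ) • (-(negSq v ⊗ₜ[ℝ] (1 : SuperClifford m n))) := by
    rw [two_smul]
    nth_rewrite 2 [hS]
    rw [Finset.sum_comm, hS, ← Finset.sum_add_distrib]
    simp only [← Finset.sum_add_distrib, key]
    simp only [Fintype.sum_sum_type, symp, zero_smul, Finset.sum_const_zero, ite_smul,
      Finset.sum_ite_eq, Finset.sum_ite_eq', Finset.mem_univ, if_true, add_zero, zero_add]
    simp only [TensorProduct.smul_tmul', ← TensorProduct.sum_tmul, ← TensorProduct.add_tmul,
      ← TensorProduct.neg_tmul]
    congr 1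
    have : ∀ j : Fin n, v (Sum.inr (Sum.inr j)) * v (Sum.inr (Sum.inl j)) =
      -(v (Sum.inr (Sum.inl j)) * v (Sum.inr (Sum.inr j))) := fun j => hodd _ _
    simp only [this, ← Finset.smul_sum, negSq, Finset.sum_neg_distrib]
    module
  exact smul_right_injective _ (two_ne_zero (α := ℝ)) h2

end

end SuperSpace

/-! Modulo multiples of `g`, both `∂[hg]` and `|∂[hg]|` are `h` times the corresponding object for
`g`. For the gradient this is the Leibniz rule. It gives `-∂[hg]² = h²(-∂[g]²) + gW`, so the
difference of `|∂[hg]|` and `h|∂[g]|`, multiplied by their sum, is `gW`; the sum has positive body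
near the surface, hence can be divided out (`exists_absGrad_mul`). Both identities then follow from
two rules: `g δ(g) = 0` (`superDelta_mul_self`) and `h δ(hg) = δ(g)` (`superDelta_mul_pos`). Since
`h` is invertible, the first rule for `hg` also yields `g δ(hg) = 0`.

With bodies `g₀`, `h₀`, these rules rest on the scalar relations `g₀ δ^{(j+1)}(g₀) = -(j+1)
δ^{(j)}(g₀)` (`deltaD_succ_mul_self`) and `h₀^{j+1} δ^{(j)}(h₀g₀) = δ^{(j)}(g₀)` (`deltaD_mul_pos`).
The former makes the sum for `g δ(g)` telescope. For `h δ(hg)`, powers of the nilpotent part of `hg`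
are expanded binomially and matched with the expansion of `h^{-(k+1)}`; products of more than `n`
even nilpotent factors vanish, so the truncations agree.

The scalar relations come from integration by parts, without a surface measure. A function supported
where `∇g₀ ≠ 0` has the form `V·∇g₀`, and `d/dt ∫_{g₀<t} V·∇g₀ = ∫_{g₀<t} div V`. This lowers the
order of `δ^{(j)}`, and by induction a `C^k` function has a `C^{k+1}` sublevel integral
(`contDiff_sublevel`). Merely continuous functions are reached by approximation, using that fibre
integration is positive. The functions `g₀` and `h₀g₀` are compared only through `{h₀g₀ < 0} = {g₀ <
0}`. Finally `hasDeltaPairing_of_bump` passes from compactly supported functions to the localised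
pairing of the definitions. -/

namespace SuperSpace

open MeasureTheory Filter Set

noncomputable section

variable {m : ℕ}

/-! ### Compactly supported functions in an open set, and vector fields -/

/-- `f` is of class `C^k`, with compact support contained in `O`. -/
structure IsCkSupp (k : WithTop ℕ∞) (O : Set (Bos m)) (f : Bos m → ℝ) : Prop where
  contDiff : ContDiff ℝ k f
  hasCompactSupport : HasCompactSupport f
  tsupport_subset : tsupport f ⊆ O

/-- The partial derivative of a real function. -/
def pderiv (i : Fin m) (f : Bos m → ℝ) (x : Bos m) : ℝ :=
  fderiv ℝ f x (EuclideanSpace.single i 1)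

/-- The divergence of a vector field. -/
def divergence (V : Fin m → Bos m → ℝ) (x : Bos m) : ℝ := ∑ i, pderiv i (V i) x

/-- The derivative of a function along a vector field. -/
def alongDeriv (V : Fin m → Bos m → ℝ) (g : Bos m → ℝ) (x : Bos m) : ℝ := ∑ i, V i x * pderiv i g x

theorem contDiff_pderiv {k l : WithTop ℕ∞} {f : Bos m → ℝ} (hf : ContDiff ℝ l f) (hkl : k + 1 ≤ l)
    (i : Fin m) : ContDiff ℝ k (pderiv i f) :=
  (hf.fderiv_right hkl).clm_apply contDiff_const

theorem tsupport_pderiv_subset (f : Bos m → ℝ) (i : Fin m) :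
    tsupport (pderiv i f) ⊆ tsupport f :=
  tsupport_fderiv_apply_subset ℝ _

theorem pderiv_mul {f g : Bos m → ℝ} {x : Bos m} (hf : DifferentiableAt ℝ f x)
    (hg : DifferentiableAt ℝ g x) (i : Fin m) :
    pderiv i (fun y => f y * g y) x = f x * pderiv i g x + g x * pderiv i f x := by
  simp [pderiv, fderiv_fun_mul hf hg]

theorem sum_pderiv_sq_pos {g : Bos m → ℝ} {x : Bos m} (hx : fderiv ℝ g x ≠ 0) :
    0 < ∑ i, pderiv i g x * pderiv i g x := by
  by_contra hcon
  have h0 : ∑ i, pderiv i g x * pderiv i g x = 0 :=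
    le_antisymm (not_lt.1 hcon) (Finset.sum_nonneg fun i _ => mul_self_nonneg _)
  rw [Finset.sum_eq_zero_iff_of_nonneg fun i _ => mul_self_nonneg _] at h0
  apply hx
  have hlin : (fderiv ℝ g x).toLinearMap = 0 := by
    refine (EuclideanSpace.basisFun (Fin m) ℝ).toBasis.ext fun i => ?_
    simpa [pderiv] using h0 i (Finset.mem_univ i)
  ext v
  exact congrArg (fun l : Bos m →ₗ[ℝ] ℝ => l v) hlin

namespace IsCkSupp

variable {k l : WithTop ℕ∞} {O : Set (Bos m)} {f f' : Bos m → ℝ}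

theorem continuous (hf : IsCkSupp k O f) : Continuous f := hf.contDiff.continuous

theorem of_le (hf : IsCkSupp l O f) (hkl : k ≤ l) : IsCkSupp k O f :=
  ⟨hf.contDiff.of_le hkl, hf.hasCompactSupport, hf.tsupport_subset⟩

theorem integrable (hf : IsCkSupp k O f) : Integrable f :=
  hf.continuous.integrable_of_hasCompactSupport hf.hasCompactSupport

theorem of_subset (hf : IsCkSupp k O f) (hf' : ContDiff ℝ l f')
    (h : tsupport f' ⊆ tsupport f) : IsCkSupp l O f' :=
  ⟨hf', hf.hasCompactSupport.of_isClosed_subset (isClosed_tsupport _) h,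
    h.trans hf.tsupport_subset⟩

theorem add (hf : IsCkSupp k O f) (hf' : IsCkSupp k O f') : IsCkSupp k O (fun x => f x + f' x) :=
  ⟨hf.contDiff.add hf'.contDiff, hf.hasCompactSupport.add hf'.hasCompactSupport,
    (tsupport_add f f').trans (union_subset hf.tsupport_subset hf'.tsupport_subset)⟩

theorem mul_left (hf : IsCkSupp k O f) {a : Bos m → ℝ} (ha : ContDiff ℝ k a) :
    IsCkSupp k O (fun x => a x * f x) :=
  hf.of_subset (ha.mul hf.contDiff) (tsupport_mul_subset_right (f := a))

theorem const_mul (hf : IsCkSupp k O f) (c : ℝ) : IsCkSupp k O (fun x => c * f x) :=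
  hf.mul_left contDiff_const

theorem sub (hf : IsCkSupp k O f) (hf' : IsCkSupp k O f') : IsCkSupp k O (fun x => f x - f' x) := by
  simpa [sub_eq_add_neg] using hf.add (hf'.const_mul (-1))

theorem zero : IsCkSupp k O (fun _ => 0) :=
  ⟨contDiff_const, HasCompactSupport.zero, by simp [tsupport]⟩

theorem sum {ι : Type*} (s : Finset ι) {F : ι → Bos m → ℝ} (hF : ∀ i ∈ s, IsCkSupp k O (F i)) :
    IsCkSupp k O (fun x => ∑ i ∈ s, F i x) := by
  classical
  induction s using Finset.induction_on with
  | empty => simpa using zero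
  | insert a s ha ih =>
    simp only [Finset.sum_insert ha]
    exact (hF a (Finset.mem_insert_self a s)).add
      (ih fun i hi => hF i (Finset.mem_insert_of_mem hi))

theorem pderiv (hf : IsCkSupp l O f) (hkl : k + 1 ≤ l) (i : Fin m) :
    IsCkSupp k O (pderiv i f) :=
  hf.of_subset (contDiff_pderiv hf.contDiff hkl i) (tsupport_pderiv_subset f i)

theorem divergence {V : Fin m → Bos m → ℝ} (hV : ∀ i, IsCkSupp l O (V i)) (hkl : k + 1 ≤ l) :
    IsCkSupp k O (divergence V) :=
  sum _ fun i _ => (hV i).pderiv hkl i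

theorem alongDeriv {V : Fin m → Bos m → ℝ} (hV : ∀ i, IsCkSupp k O (V i)) {g : Bos m → ℝ}
    (hg : ContDiff ℝ ∞ g) (hk : k ≤ ∞) : IsCkSupp k O (alongDeriv V g) := by
  have h (i : Fin m) : ContDiff ℝ k (SuperSpace.pderiv i g) :=
    (contDiff_pderiv (k := ∞) hg (by simp) i).of_le hk
  refine (sum Finset.univ fun i _ => (hV i).mul_left (h i)).of_subset
    (ContDiff.sum fun i _ => (hV i).contDiff.mul (h i)) ?_
  simp only [mul_comm]
  exact subset_rfl

/-- Products with functions that are regular on `O` only. -/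
theorem mul_contDiffOn (hf : IsCkSupp k O f) (hO : IsOpen O) {a : Bos m → ℝ}
    (ha : ContDiffOn ℝ k a O) : IsCkSupp k O (fun x => a x * f x) := by
  refine hf.of_subset (contDiff_iff_contDiffAt.2 fun x => ?_) (tsupport_mul_subset_right (f := a))
  by_cases hx : x ∈ tsupport f
  · exact ((ha x (hf.tsupport_subset hx)).contDiffAt
      (hO.mem_nhds (hf.tsupport_subset hx))).mul hf.contDiff.contDiffAt
  · refine (contDiffAt_const (c := (0 : ℝ))).congr_of_eventuallyEq ?_
    filter_upwards [notMem_tsupport_iff_eventuallyEq.1 hx] with y hy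
    simp [hy]

/-- Functions supported in the regular set of `g` are derivatives of `g`. -/
theorem exists_alongDeriv_eq {g : Bos m → ℝ} (hg : ContDiff ℝ ∞ g) (hO : IsOpen O)
    (hreg : ∀ x ∈ O, fderiv ℝ g x ≠ 0) (hk : k ≤ ∞) (hf : IsCkSupp k O f) :
    ∃ V : Fin m → Bos m → ℝ, (∀ i, IsCkSupp k O (V i)) ∧
      SuperSpace.alongDeriv V g = f := by
  have hp (i : Fin m) : ContDiff ℝ ∞ (SuperSpace.pderiv i g) := contDiff_pderiv hg (by simp) i
  -- The field is `V = f ∇g / |∇g|²`. The quotient is regular only on `O`, which suffices because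
  -- `f` vanishes near every point outside its support.
  refine ⟨fun i x => SuperSpace.pderiv i g x /
    (∑ i, SuperSpace.pderiv i g x * SuperSpace.pderiv i g x) * f x, fun i => ?_, ?_⟩
  · refine hf.mul_contDiffOn hO ?_
    exact ((hp i).of_le hk).contDiffOn.div
      (((ContDiff.sum fun i _ => (hp i).mul (hp i)).of_le hk).contDiffOn)
      fun x hx => (sum_pderiv_sq_pos (hreg x hx)).ne'
  · ext x
    by_cases hx : x ∈ O
    · have := (sum_pderiv_sq_pos (hreg x hx)).ne'
      simp only [SuperSpace.alongDeriv]
      rw [Finset.sum_congr rfl fun i _ => show _ = (SuperSpace.pderiv i g x *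
        SuperSpace.pderiv i g x) * (f x / (∑ i, SuperSpace.pderiv i g x *
          SuperSpace.pderiv i g x)) by ring, ← Finset.sum_mul, mul_div_cancel₀ _ this]
    · have : f x = 0 := image_eq_zero_of_notMem_tsupport fun h => hx (hf.tsupport_subset h)
      simp [SuperSpace.alongDeriv, this]

end IsCkSupp

theorem exists_bump {K O : Set (Bos m)} (hK : IsCompact K) (hO : IsOpen O) (hKO : K ⊆ O) :
    ∃ χ : Bos m → ℝ, IsCkSupp ∞ O χ ∧ (∀ᶠ x in 𝓝ˢ K, χ x = 1) ∧ ∀ x, 0 ≤ χ x := by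
  obtain ⟨L, hL, hKL, hLO⟩ := exists_compact_between hK hO hKO
  obtain ⟨f, h1, h0, h⟩ := exists_contMDiffMap_one_nhds_of_subset_interior
    (modelWithCornersSelf ℝ (Bos m)) (n := ⊤) hK.isClosed hKL
  have hs : tsupport f ⊆ L :=
    closure_minimal (fun x hx => by_contra fun h => hx (h0 x h)) hL.isClosed
  exact ⟨f, ⟨f.contMDiff.contDiff, hL.of_isClosed_subset (isClosed_tsupport _) hs, hs.trans hLO⟩,
    h1, fun x => (h x).1⟩

/-- Smooth approximation with controlled supports. -/
theorem IsCkSupp.exists_approx {O : Set (Bos m)} {f : Bos m → ℝ} (hO : IsOpen O)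
    (hf : IsCkSupp 0 O f) :
    ∃ (ψ : Bos m → ℝ) (F : ℕ → Bos m → ℝ), IsCkSupp ∞ O ψ ∧ (∀ x, 0 ≤ ψ x) ∧
      (∀ k, IsCkSupp ∞ O (F k)) ∧ ∀ k x, |F k x - f x| ≤ 1 / ((k : ℝ) + 1) * ψ x := by
  obtain ⟨ψ, hψ, h1, hψ0⟩ := exists_bump hf.hasCompactSupport hO hf.tsupport_subset
  have huc := hf.hasCompactSupport.uniformContinuous_of_continuous hf.continuous
  have (k : ℕ) := huc.exists_contDiff_dist_le (ε := 1 / ((k : ℝ) + 1)) (by positivity)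
  choose F hF hFd using this
  -- The cutoff `ψ` is one on the support of `f`, so `f = fψ`; multiplying the approximants by it
  -- confines their supports to `O` and turns the uniform error into the majorant `ψ / (k + 1)`.
  refine ⟨ψ, fun k x => F k x * ψ x, hψ, hψ0, fun k => hψ.mul_left (hF k), fun k x => ?_⟩
  have hfx : f x = f x * ψ x := by
    by_cases hx : x ∈ tsupport f
    · rw [h1.self_of_nhdsSet x hx, mul_one]
    · simp [image_eq_zero_of_notMem_tsupport hx]
  rw [hfx, ← sub_mul, abs_mul, abs_of_nonneg (hψ0 x)]
  exact mul_le_mul_of_nonneg_right (hFd k x).le (hψ0 x)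

end

end SuperSpace

namespace SuperSpace

open MeasureTheory Filter Set

noncomputable section

variable {m : ℕ}

/-! ### Integrals over sublevel sets -/

/-- The function `t ↦ ∫_{g < t} f dV`. -/
def sublevel (g f : Bos m → ℝ) (t : ℝ) : ℝ := ∫ x in {x | g x < t}, f x

/-- The function `t ↦ ∫ (t - g)₊ f dV`. -/
def ramp (g f : Bos m → ℝ) (t : ℝ) : ℝ := ∫ x, max (t - g x) 0 * f x

/-- The function `t ↦ ∫ (t - g)₊² / 2 f dV`. -/
def ramp2 (g f : Bos m → ℝ) (t : ℝ) : ℝ := ∫ x, max (t - g x) 0 ^ 2 / 2 * f x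

/-- Twice integrating the Heaviside function gives a `C¹` function, regular enough for integration
by parts and differentiation under the integral. At the kink the function is bounded by `s²`. -/
theorem hasDerivAt_max_sq (s : ℝ) : HasDerivAt (fun s : ℝ => max s 0 ^ 2 / 2) (max s 0) s := by
  rcases lt_trichotomy s 0 with h | h | h
  · rw [max_eq_right h.le]
    refine (hasDerivAt_const s (0 : ℝ)).congr_of_eventuallyEq ?_
    filter_upwards [gt_mem_nhds h] with y hy
    simp [max_eq_right (le_of_lt hy)]
  · subst h
    rw [max_self, hasDerivAt_iff_isLittleO_nhds_zero]
    have h2 : (fun h : ℝ => h ^ 2) =o[𝓝 0] fun h => h := by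
      simpa using Asymptotics.isLittleO_pow_id (one_lt_two)
    refine Asymptotics.IsBigO.trans_isLittleO (Asymptotics.IsBigO.of_bound 1 ?_) h2
    refine Eventually.of_forall fun y => ?_
    rcases le_total y 0 with h | h
    · simp [max_eq_right h]; positivity
    · simp [max_eq_left h]
      nlinarith [sq_nonneg y]
  · rw [max_eq_left h.le]
    have : HasDerivAt (fun s : ℝ => s ^ 2 / 2) s s := by
      have := (hasDerivAt_pow 2 s).div_const 2
      simpa using this
    refine this.congr_of_eventuallyEq ?_
    filter_upwards [lt_mem_nhds h] with y hy
    simp [max_eq_left (le_of_lt hy)]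

/-- Integration by parts against a function of `g`. -/
theorem integral_alongDeriv {g : Bos m → ℝ} (hg : ContDiff ℝ ∞ g) {Φ φ : ℝ → ℝ}
    (hΦ : ∀ s, HasDerivAt Φ (φ s) s) (hφ : Continuous φ) {O : Set (Bos m)}
    {V : Fin m → Bos m → ℝ} (hV : ∀ i, IsCkSupp 1 O (V i)) :
    ∫ x, φ (g x) * alongDeriv V g x = -∫ x, Φ (g x) * divergence V x := by
  have hΦc : Continuous Φ := continuous_iff_continuousAt.2 fun s => (hΦ s).continuousAt
  have hgc := hg.continuous
  have hd (x) : DifferentiableAt ℝ g x := hg.differentiable (by simp) x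
  have hp (i : Fin m) : Continuous (pderiv i g) :=
    (contDiff_pderiv (k := ∞) hg (by simp) i).continuous
  have hfd (i : Fin m) (x : Bos m) :
      fderiv ℝ (fun x => Φ (g x)) x (EuclideanSpace.single i 1) = φ (g x) * pderiv i g x := by
    have : HasFDerivAt (fun x => Φ (g x)) (φ (g x) • fderiv ℝ g x) x :=
      (hΦ (g x)).comp_hasFDerivAt x (hd x).hasFDerivAt
    simp [this.fderiv, pderiv]
  have hI1 (i : Fin m) : Integrable (fun x => φ (g x) * (V i x * pderiv i g x)) :=
    Continuous.integrable_of_hasCompactSupport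
      ((hφ.comp hgc).mul ((hV i).continuous.mul (hp i)))
      ((hV i).hasCompactSupport.mul_right.mul_left)
  have hI2 (i : Fin m) : Integrable (fun x => Φ (g x) * pderiv i (V i) x) :=
    Continuous.integrable_of_hasCompactSupport
      ((hΦc.comp hgc).mul ((hV i).pderiv (k := 0) (by simp) i).continuous)
      (((hV i).pderiv (k := 0) (by simp) i).hasCompactSupport.mul_left)
  simp only [alongDeriv, divergence, Finset.mul_sum]
  rw [integral_finsetSum _ fun i _ => hI1 i, integral_finsetSum _ fun i _ => hI2 i,
    ← Finset.sum_neg_distrib]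
  refine Finset.sum_congr rfl fun i _ => ?_
  have key := integral_mul_fderiv_eq_neg_fderiv_mul_of_integrable (𝕜 := ℝ) (μ := volume)
    (f := fun x => Φ (g x)) (g := V i) (v := EuclideanSpace.single i 1) ?_ (hI2 i) ?_
    (fun x _ => ((hΦ (g x)).comp_hasFDerivAt x (hd x).hasFDerivAt).differentiableAt)
    (fun x _ => (hV i).contDiff.differentiable (by simp) x)
  · rw [eq_neg_iff_add_eq_zero, add_comm, ← eq_neg_iff_add_eq_zero]
    refine key.trans ?_
    simp only [hfd]
    congr 1
    refine integral_congr_ae (Eventually.of_forall fun x => ?_)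
    simp only []
    ring
  · simp only [hfd]
    refine (hI1 i).congr (Eventually.of_forall fun x => ?_)
    simp only []
    ring
  · exact Continuous.integrable_of_hasCompactSupport ((hΦc.comp hgc).mul (hV i).continuous)
      ((hV i).hasCompactSupport.mul_left)

variable {g : Bos m → ℝ} {O : Set (Bos m)}

/-- The divergence theorem for `{g < t}`, two integrations in `t` removed, so that no boundary term
and no regularity of the level sets enters. -/
theorem ramp_alongDeriv (hg : ContDiff ℝ ∞ g) {V : Fin m → Bos m → ℝ}
    (hV : ∀ i, IsCkSupp 1 O (V i)) : ramp g (alongDeriv V g) = ramp2 g (divergence V) := by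
  ext t
  have := integral_alongDeriv hg (Φ := fun s => -(max (t - s) 0 ^ 2 / 2))
    (φ := fun s => max (t - s) 0) (fun s => ?_) (by fun_prop) hV
  · simpa [ramp, ramp2, integral_neg] using this
  · have h := ((hasDerivAt_max_sq (t - s)).comp s ((hasDerivAt_id s).const_sub t)).neg
    exact HasDerivAt.congr_deriv (f := fun s => -(max (t - s) 0 ^ 2 / 2)) h (by simp)

theorem abs_max_sub_le (t s : ℝ) : |max (t - s) 0| ≤ |t| + |s| := by
  rw [abs_of_nonneg (le_max_right _ _)]
  refine max_le ?_ (by positivity)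
  linarith [le_abs_self t, neg_abs_le s]

theorem hasDerivAt_ramp2 (hg : ContDiff ℝ ∞ g) {f : Bos m → ℝ} (hf : IsCkSupp 0 O f) (t : ℝ) :
    HasDerivAt (ramp2 g f) (ramp g f t) t := by
  have hgc := hg.continuous
  have hfc := hf.continuous
  refine (hasDerivAt_integral_of_dominated_loc_of_deriv_le (𝕜 := ℝ)
    (F := fun t x => max (t - g x) 0 ^ 2 / 2 * f x)
    (F' := fun t x => max (t - g x) 0 * f x) (bound := fun x => (|t| + 1 + |g x|) * |f x|)
    (Metric.ball_mem_nhds t one_pos) ?_ ?_ ?_ ?_ ?_ ?_).2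
  · exact Eventually.of_forall fun s => Continuous.aestronglyMeasurable (by fun_prop)
  · exact Continuous.integrable_of_hasCompactSupport (by fun_prop) hf.hasCompactSupport.mul_left
  · exact Continuous.aestronglyMeasurable (by fun_prop)
  · refine Eventually.of_forall fun x s hs => ?_
    rw [norm_mul, Real.norm_eq_abs, Real.norm_eq_abs]
    refine mul_le_mul_of_nonneg_right ((abs_max_sub_le s (g x)).trans ?_) (abs_nonneg _)
    have h1 : |s - t| < 1 := by simpa [Real.dist_eq] using hs
    have h2 : |s| ≤ |s - t| + |t| := by simpa using abs_add_le (s - t) t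
    linarith
  · refine Continuous.integrable_of_hasCompactSupport (by fun_prop) ?_
    exact (hf.hasCompactSupport.comp_left (g := fun y : ℝ => |y|) (by simp)).mul_left
  · refine Eventually.of_forall fun x s _ => ?_
    have h := (hasDerivAt_max_sq (s - g x)).comp s ((hasDerivAt_id s).sub_const (g x))
    simpa [Function.comp_def] using h.mul_const (f x)

theorem measurableSet_sublevel (hg : ContDiff ℝ ∞ g) (t : ℝ) : MeasurableSet {x | g x < t} :=
  (isOpen_lt hg.continuous continuous_const).measurableSet

/-- The left derivative of `ramp` is `sublevel`. -/
theorem sublevel_eq_of_hasDerivAt_ramp (hg : ContDiff ℝ ∞ g) {f : Bos m → ℝ}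
    (hf : IsCkSupp 0 O f) {t c : ℝ} (h : HasDerivAt (ramp g f) c t) : sublevel g f t = c := by
  have hgc := hg.continuous
  have hfc := hf.continuous
  have hI (s : ℝ) : Integrable (fun x => max (s - g x) 0 * f x) :=
    Continuous.integrable_of_hasCompactSupport (by fun_prop) hf.hasCompactSupport.mul_left
  -- Difference quotients from the left tend to the indicator of the strict set `{g < t}`; from the
  -- right they would give `{g ≤ t}`, and level sets are not known to be null here.
  have hlim : Tendsto (fun k : ℕ => t - 1 / ((k : ℝ) + 1)) atTop (𝓝[≠] t) := by
    refine tendsto_nhdsWithin_iff.2 ⟨?_, Eventually.of_forall fun k => ?_⟩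
    · simpa using tendsto_const_nhds (x := t).sub tendsto_one_div_add_atTop_nhds_zero_nat
    · have : (0 : ℝ) < 1 / ((k : ℝ) + 1) := by positivity
      simp only [mem_compl_iff, mem_singleton_iff]
      linarith
  refine tendsto_nhds_unique ?_ ((hasDerivAt_iff_tendsto_slope.1 h).comp hlim)
  have hslope (k : ℕ) : (slope (ramp g f) t ∘ fun k : ℕ => t - 1 / ((k : ℝ) + 1)) k =
      ∫ x, ((k : ℝ) + 1) * (max (t - g x) 0 - max (t - 1 / ((k : ℝ) + 1) - g x) 0) * f x := by
    have hk : (k : ℝ) + 1 ≠ 0 := by positivity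
    simp only [Function.comp, slope_def_field, ramp, sub_mul, mul_assoc]
    rw [integral_const_mul, integral_sub (hI _) (hI _)]
    field_simp
    ring
  simp only [funext hslope]
  rw [sublevel, ← integral_indicator (measurableSet_sublevel hg t)]
  refine tendsto_integral_of_dominated_convergence (fun x => |f x|) (fun k => ?_)
    hf.integrable.abs (fun k => Eventually.of_forall fun x => ?_)
    (Eventually.of_forall fun x => ?_)
  · exact Continuous.aestronglyMeasurable (by fun_prop)
  · have hk : (0 : ℝ) < (k : ℝ) + 1 := by positivity
    rw [norm_mul, Real.norm_eq_abs, Real.norm_eq_abs, abs_mul, abs_of_pos hk]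
    refine mul_le_of_le_one_left (abs_nonneg _) ?_
    have h1 := abs_max_sub_max_le_abs (t - g x) (t - 1 / ((k : ℝ) + 1) - g x) 0
    have h2 : t - g x - (t - 1 / ((k : ℝ) + 1) - g x) = 1 / ((k : ℝ) + 1) := by ring
    rw [h2, abs_of_pos (a := 1 / ((k : ℝ) + 1)) (by positivity)] at h1
    calc _ ≤ ((k : ℝ) + 1) * (1 / ((k : ℝ) + 1)) := mul_le_mul_of_nonneg_left h1 hk.le
      _ = 1 := by field_simp
  · refine tendsto_const_nhds.congr' ?_
    by_cases hx : g x < t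
    · have h0 : 0 < t - g x := sub_pos.2 hx
      filter_upwards [tendsto_one_div_add_atTop_nhds_zero_nat.eventually_lt_const h0] with k hk
      have hk' : (k : ℝ) + 1 ≠ 0 := by positivity
      rw [indicator_of_mem (show x ∈ {x | g x < t} from hx), max_eq_left h0.le,
        max_eq_left (by linarith)]
      field_simp
      ring
    · refine Eventually.of_forall fun k => ?_
      have : (0 : ℝ) < 1 / ((k : ℝ) + 1) := by positivity
      have hx' := not_lt.1 hx
      beta_reduce
      rw [indicator_of_notMem (show x ∉ {x | g x < t} from hx),
        max_eq_right (a := t - g x) (by linarith),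
        max_eq_right (a := t - 1 / ((k : ℝ) + 1) - g x) (by linarith)]
      simp

/-- Differentiating `ramp_alongDeriv` in `t` gives the result: the right side has derivative `ramp g
(divergence V)`, and any derivative of the left side must be the sublevel integral. -/
theorem sublevel_alongDeriv (hg : ContDiff ℝ ∞ g) {V : Fin m → Bos m → ℝ}
    (hV : ∀ i, IsCkSupp 1 O (V i)) : sublevel g (alongDeriv V g) = ramp g (divergence V) := by
  ext t
  have h := hasDerivAt_ramp2 hg (IsCkSupp.divergence (k := 0) hV (by simp)) t
  rw [← ramp_alongDeriv hg hV] at h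
  exact sublevel_eq_of_hasDerivAt_ramp hg
    ((IsCkSupp.alongDeriv hV hg (by simp)).of_le zero_le_one) h

theorem hasDerivAt_ramp_alongDeriv (hg : ContDiff ℝ ∞ g) {V : Fin m → Bos m → ℝ}
    (hV : ∀ i, IsCkSupp 1 O (V i)) (t : ℝ) :
    HasDerivAt (ramp g (alongDeriv V g)) (sublevel g (alongDeriv V g) t) t := by
  rw [sublevel_alongDeriv hg hV, ramp_alongDeriv hg hV]
  exact hasDerivAt_ramp2 hg (IsCkSupp.divergence (k := 0) hV (by simp)) t

/-! Linearity and bounds -/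

theorem sublevel_add {f f' : Bos m → ℝ} (hf : IsCkSupp 0 O f) (hf' : IsCkSupp 0 O f') (t : ℝ) :
    sublevel g (fun x => f x + f' x) t = sublevel g f t + sublevel g f' t :=
  integral_add hf.integrable.integrableOn hf'.integrable.integrableOn

theorem sublevel_sub {f f' : Bos m → ℝ} (hf : IsCkSupp 0 O f) (hf' : IsCkSupp 0 O f') (t : ℝ) :
    sublevel g (fun x => f x - f' x) t = sublevel g f t - sublevel g f' t :=
  integral_sub hf.integrable.integrableOn hf'.integrable.integrableOn

theorem sublevel_const_mul (c : ℝ) (f : Bos m → ℝ) (t : ℝ) :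
    sublevel g (fun x => c * f x) t = c * sublevel g f t :=
  integral_const_mul c _

theorem monotone_sublevel {f : Bos m → ℝ} (hf : IsCkSupp 0 O f)
    (hf0 : ∀ x, 0 ≤ f x) : Monotone (sublevel g f) := by
  intro s t hst
  refine setIntegral_mono_set hf.integrable.integrableOn (Eventually.of_forall hf0) ?_
  exact Eventually.of_forall fun x (hx : g x < s) => lt_of_lt_of_le hx hst

/-- The bound does not depend on `t`, as uniform convergence of sublevel integrals requires. -/
theorem abs_sublevel_sub_le {f f' ψ : Bos m → ℝ} (hf : IsCkSupp 0 O f) (hf' : IsCkSupp 0 O f')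
    (hψ : IsCkSupp 0 O ψ) (hψ0 : ∀ x, 0 ≤ ψ x) {δ : ℝ} (hδ : 0 ≤ δ)
    (h : ∀ x, |f x - f' x| ≤ δ * ψ x) (t : ℝ) :
    |sublevel g f t - sublevel g f' t| ≤ δ * ∫ x, ψ x := by
  rw [← sublevel_sub hf hf']
  refine (norm_integral_le_of_norm_le (f := fun x => f x - f' x)
    (hψ.const_mul δ).integrable.integrableOn (Eventually.of_forall h)).trans ?_
  rw [integral_const_mul]
  refine mul_le_mul_of_nonneg_left ?_ hδ
  exact setIntegral_le_integral hψ.integrable (Eventually.of_forall hψ0)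

theorem abs_ramp_sub_le (hg : ContDiff ℝ ∞ g) {f f' ψ : Bos m → ℝ} (hf : IsCkSupp 0 O f)
    (hf' : IsCkSupp 0 O f') (hψ : IsCkSupp 0 O ψ) {δ : ℝ}
    (h : ∀ x, |f x - f' x| ≤ δ * ψ x) (t : ℝ) :
    |ramp g f t - ramp g f' t| ≤ δ * ramp g ψ t := by
  have hgc := hg.continuous
  have hI {f : Bos m → ℝ} (hf : IsCkSupp 0 O f) : Integrable (fun x => max (t - g x) 0 * f x) :=
    (hf.mul_left (a := fun x => max (t - g x) 0) (contDiff_zero.2 (by fun_prop))).integrable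
  rw [ramp, ramp, ← integral_sub (hI hf) (hI hf'), ramp, ← integral_const_mul]
  refine norm_integral_le_of_norm_le (f := fun x => max (t - g x) 0 * f x - max (t - g x) 0 * f' x)
    ((hI hψ).const_mul δ) (Eventually.of_forall fun x => ?_)
  rw [← mul_sub, norm_mul, Real.norm_eq_abs, Real.norm_eq_abs,
    abs_of_nonneg (le_max_right _ _)]
  calc _ ≤ max (t - g x) 0 * (δ * ψ x) := mul_le_mul_of_nonneg_left (h x) (le_max_right _ _)
    _ = _ := by ring

end

end SuperSpace

namespace SuperSpace

open MeasureTheory Filter Set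

noncomputable section

variable {m : ℕ} {g : Bos m → ℝ} {O : Set (Bos m)}

/-! ### Regularity of the sublevel integrals -/

theorem natCast_le_infty (k : ℕ) : (k : WithTop ℕ∞) ≤ ∞ := mod_cast le_top

theorem tendstoUniformly_of_abs_sub_le {α : Type*} {F : ℕ → α → ℝ} {f : α → ℝ} {C : ℝ}
    (h : ∀ k t, |F k t - f t| ≤ 1 / ((k : ℝ) + 1) * C) : TendstoUniformly F f atTop := by
  rw [Metric.tendstoUniformly_iff]
  intro ε hε
  have hlim : Tendsto (fun k : ℕ => 1 / ((k : ℝ) + 1) * C) atTop (𝓝 0) := by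
    simpa using tendsto_one_div_add_atTop_nhds_zero_nat.mul_const C
  filter_upwards [hlim.eventually_lt_const hε] with k hk t
  rw [dist_comm, Real.dist_eq]
  exact (h k t).trans_lt hk

theorem tendsto_of_abs_sub_le {F : ℕ → ℝ} {f C : ℝ}
    (h : ∀ k, |F k - f| ≤ 1 / ((k : ℝ) + 1) * C) : Tendsto F atTop (𝓝 f) :=
  (tendstoUniformly_of_abs_sub_le (F := fun k (_ : Unit) => F k) (f := fun _ => f)
    fun k _ => h k).tendsto_at ()

theorem tendstoUniformly_sublevel {f ψ : Bos m → ℝ} {F : ℕ → Bos m → ℝ} (hf : IsCkSupp 0 O f)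
    (hψ : IsCkSupp 0 O ψ) (hψ0 : ∀ x, 0 ≤ ψ x) (hF : ∀ k, IsCkSupp 0 O (F k))
    (h : ∀ k x, |F k x - f x| ≤ 1 / ((k : ℝ) + 1) * ψ x) :
    TendstoUniformly (fun k => sublevel g (F k)) (sublevel g f) atTop :=
  tendstoUniformly_of_abs_sub_le fun k t =>
    abs_sublevel_sub_le (hF k) hf hψ hψ0 (by positivity) (h k) t

/-- Smooth approximants supported in the regular set are of the form `V·∇g`, where the claim is
known. Their derivatives, the sublevel integrals, converge uniformly in `t`, so the claim passes to
the limit. -/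
theorem hasDerivAt_ramp (hg : ContDiff ℝ ∞ g) (hO : IsOpen O) (hreg : ∀ x ∈ O, fderiv ℝ g x ≠ 0)
    {f : Bos m → ℝ} (hf : IsCkSupp 0 O f) (t : ℝ) :
    HasDerivAt (ramp g f) (sublevel g f t) t := by
  obtain ⟨ψ, F, hψ, hψ0, hF, h⟩ := hf.exists_approx hO
  refine hasDerivAt_of_tendstoUniformly (f := fun k => ramp g (F k)) (tendstoUniformly_sublevel (g := g) hf
    (hψ.of_le (by simp)) hψ0 (fun k => (hF k).of_le (by simp)) h)
    (Eventually.of_forall fun k s => ?_) (fun s => ?_) t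
  · obtain ⟨V, hV, hVF⟩ := (hF k).exists_alongDeriv_eq hg hO hreg le_rfl
    rw [← hVF]
    exact hasDerivAt_ramp_alongDeriv hg (fun i => (hV i).of_le (by simp)) s
  · exact tendsto_of_abs_sub_le fun k => abs_ramp_sub_le hg ((hF k).of_le (by simp)) hf
      (hψ.of_le (by simp)) (h k) s

/-- The derivative of the integral of `V · ∇g` over the sublevel sets of `g` is the integral of
the divergence of `V`. -/
theorem hasDerivAt_sublevel_alongDeriv (hg : ContDiff ℝ ∞ g) (hO : IsOpen O)
    (hreg : ∀ x ∈ O, fderiv ℝ g x ≠ 0) {V : Fin m → Bos m → ℝ} (hV : ∀ i, IsCkSupp 1 O (V i))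
    (t : ℝ) : HasDerivAt (sublevel g (alongDeriv V g)) (sublevel g (divergence V) t) t := by
  rw [sublevel_alongDeriv hg hV]
  exact hasDerivAt_ramp hg hO hreg (IsCkSupp.divergence hV (by simp)) t

theorem deriv_sublevel_alongDeriv (hg : ContDiff ℝ ∞ g) (hO : IsOpen O)
    (hreg : ∀ x ∈ O, fderiv ℝ g x ≠ 0) {V : Fin m → Bos m → ℝ}
    (hV : ∀ i, IsCkSupp 1 O (V i)) :
    deriv (sublevel g (alongDeriv V g)) = sublevel g (divergence V) :=
  funext fun t => (hasDerivAt_sublevel_alongDeriv hg hO hreg hV t).deriv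

/-- Positivity of fibre integration: `δψ ± f` are nonnegative, so their sublevel integrals are
monotone in `t` and have nonnegative derivatives. This replaces estimates by a surface measure. -/
theorem abs_deriv_sublevel_le {f ψ : Bos m → ℝ} (hf : IsCkSupp 0 O f) (hψ : IsCkSupp 0 O ψ)
    {t δ : ℝ} (hft : DifferentiableAt ℝ (sublevel g f) t)
    (hψt : DifferentiableAt ℝ (sublevel g ψ) t) (h : ∀ x, |f x| ≤ δ * ψ x) :
    |deriv (sublevel g f) t| ≤ δ * deriv (sublevel g ψ) t := by
  have h1 := (monotone_sublevel (g := g) ((hψ.const_mul δ).add hf)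
    fun x => by linarith [neg_abs_le (f x), h x]).deriv_nonneg (x := t)
  have h2 := (monotone_sublevel (g := g) ((hψ.const_mul δ).sub hf)
    fun x => by linarith [le_abs_self (f x), h x]).deriv_nonneg (x := t)
  rw [funext (sublevel_add (hψ.const_mul δ) hf), funext (sublevel_const_mul δ ψ),
    deriv_fun_add (hψt.const_mul δ) hft, deriv_const_mul _ hψt] at h1
  rw [funext (sublevel_sub (hψ.const_mul δ) hf), funext (sublevel_const_mul δ ψ),
    deriv_fun_sub (hψt.const_mul δ) hft, deriv_const_mul _ hψt] at h2
  rw [abs_le]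
  constructor <;> linarith

theorem differentiable_sublevel_of_one (hg : ContDiff ℝ ∞ g) (hO : IsOpen O)
    (hreg : ∀ x ∈ O, fderiv ℝ g x ≠ 0) {f : Bos m → ℝ} (hf : IsCkSupp 1 O f) :
    Differentiable ℝ (sublevel g f) := by
  obtain ⟨V, hV, rfl⟩ := hf.exists_alongDeriv_eq hg hO hreg (by simp)
  exact fun t => (hasDerivAt_sublevel_alongDeriv hg hO hreg hV t).differentiableAt

theorem continuous_sublevel (hg : ContDiff ℝ ∞ g) (hO : IsOpen O)
    (hreg : ∀ x ∈ O, fderiv ℝ g x ≠ 0) {f : Bos m → ℝ} (hf : IsCkSupp 0 O f) :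
    Continuous (sublevel g f) := by
  obtain ⟨ψ, F, hψ, hψ0, hF, h⟩ := hf.exists_approx hO
  exact (tendstoUniformly_sublevel (g := g) hf
    (hψ.of_le (by simp)) hψ0 (fun k => (hF k).of_le (by simp)) h).continuous
    (Eventually.of_forall fun k => (differentiable_sublevel_of_one hg hO hreg
      ((hF k).of_le (by simp))).continuous).frequently

/-- Writing `f = V·∇g` with `V` only continuous leaves no divergence to integrate, so `f` is
approximated by smooth functions. Positivity makes the derivatives of their sublevel integrals
uniformly Cauchy, hence the limit is `C¹`. -/
theorem contDiff_sublevel_zero (hg : ContDiff ℝ ∞ g) (hO : IsOpen O)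
    (hreg : ∀ x ∈ O, fderiv ℝ g x ≠ 0) {f : Bos m → ℝ} (hf : IsCkSupp 0 O f) :
    ContDiff ℝ 1 (sublevel g f) := by
  obtain ⟨ψ, F, hψ, hψ0, hF, h⟩ := hf.exists_approx hO
  have hF1 (k) : IsCkSupp 1 O (F k) := (hF k).of_le (by simp)
  have hF0 (k) : IsCkSupp 0 O (F k) := (hF k).of_le (by simp)
  have hψ0' : IsCkSupp 0 O ψ := hψ.of_le (by simp)
  have hdF (k) : Differentiable ℝ (sublevel g (F k)) :=
    differentiable_sublevel_of_one hg hO hreg (hF1 k)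
  have hdψ : Differentiable ℝ (sublevel g ψ) :=
    differentiable_sublevel_of_one hg hO hreg (hψ.of_le (by simp))
  have hcF (k) : Continuous (deriv (sublevel g (F k))) := by
    obtain ⟨V, hV, hVF⟩ := (hF1 k).exists_alongDeriv_eq hg hO hreg (by simp)
    rw [← hVF, deriv_sublevel_alongDeriv hg hO hreg hV]
    exact continuous_sublevel hg hO hreg (IsCkSupp.divergence hV (by simp))
  -- The majorant is smooth, so `ψ = V·∇g` and the derivative is a sublevel integral of `div V`;
  -- hence `C = ∫ |div V|` works for all `t`.
  obtain ⟨C, hC⟩ : ∃ C, ∀ t, deriv (sublevel g ψ) t ≤ C := by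
    obtain ⟨V, hV, hVψ⟩ := (hψ.of_le (k := 1) (by simp)).exists_alongDeriv_eq hg hO hreg (by simp)
    rw [← hVψ, deriv_sublevel_alongDeriv hg hO hreg hV]
    have hd : IsCkSupp 0 O (divergence V) := IsCkSupp.divergence hV (by simp)
    refine ⟨∫ x, |divergence V x|, fun t => (le_abs_self _).trans ?_⟩
    exact (norm_integral_le_integral_norm _).trans
      (setIntegral_le_integral hd.integrable.norm (Eventually.of_forall fun x => norm_nonneg _))
  have hdiff (k l : ℕ) (t : ℝ) : |deriv (sublevel g (F k)) t - deriv (sublevel g (F l)) t| ≤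
      (1 / ((k : ℝ) + 1) + 1 / ((l : ℝ) + 1)) * C := by
    have hsub : deriv (sublevel g fun x => F k x - F l x) t =
        deriv (sublevel g (F k)) t - deriv (sublevel g (F l)) t := by
      rw [funext (sublevel_sub (hF0 k) (hF0 l)), deriv_fun_sub (hdF k t) (hdF l t)]
    rw [← hsub]
    refine (abs_deriv_sublevel_le ((hF0 k).sub (hF0 l)) hψ0'
      (differentiable_sublevel_of_one hg hO hreg ((hF1 k).sub (hF1 l)) t) (hdψ t) fun x => ?_).trans
      (mul_le_mul_of_nonneg_left (hC t) (by positivity))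
    have := abs_sub_le (F k x) (f x) (F l x)
    rw [abs_sub_comm (f x)] at this
    linarith [h k x, h l x]
  have hlim (t : ℝ) : ∃ c, Tendsto (fun k => deriv (sublevel g (F k)) t) atTop (𝓝 c) := by
    refine cauchySeq_tendsto_of_complete (cauchySeq_of_le_tendsto_0
      (fun k : ℕ => (1 / ((k : ℝ) + 1) + 1 / ((k : ℝ) + 1)) * C) (fun k l N hk hl => ?_) ?_)
    · have hC0 : 0 ≤ C := (monotone_sublevel (g := g) hψ0' hψ0).deriv_nonneg.trans (hC 0)
      refine (hdiff k l t).trans (mul_le_mul_of_nonneg_right (add_le_add ?_ ?_) hC0)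
      · exact Nat.one_div_le_one_div hk
      · exact Nat.one_div_le_one_div hl
    · simpa using (tendsto_one_div_add_atTop_nhds_zero_nat.add
        tendsto_one_div_add_atTop_nhds_zero_nat).mul_const C
  choose L hL using hlim
  have hunif : TendstoUniformly (fun k => deriv (sublevel g (F k))) L atTop := by
    refine tendstoUniformly_of_abs_sub_le (C := C) fun k t => ?_
    have h1 : Tendsto (fun l : ℕ => (1 / ((k : ℝ) + 1) + 1 / ((l : ℝ) + 1)) * C) atTop
        (𝓝 (1 / ((k : ℝ) + 1) * C)) := by
      simpa using (tendsto_one_div_add_atTop_nhds_zero_nat.const_add (1 / ((k : ℝ) + 1))).mul_const C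
    exact le_of_tendsto_of_tendsto' ((hL t).const_sub _).abs h1 fun l => hdiff k l t
  have hd (t : ℝ) : HasDerivAt (sublevel g f) (L t) t :=
    hasDerivAt_of_tendstoUniformly hunif
      (Eventually.of_forall fun k s => (hdF k s).hasDerivAt)
      (fun s => (tendstoUniformly_sublevel (g := g) hf hψ0' hψ0 hF0 h).tendsto_at s) t
  rw [contDiff_one_iff_deriv]
  refine ⟨fun t => (hd t).differentiableAt, ?_⟩
  rw [funext fun t => (hd t).deriv]
  exact hunif.continuous (Eventually.of_forall hcF).frequently

/-- Each derivative in `t` replaces `V·∇g` by `div V` and costs one derivative of the integrand. The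
base case supplies the extra order. -/
theorem contDiff_sublevel (hg : ContDiff ℝ ∞ g) (hO : IsOpen O)
    (hreg : ∀ x ∈ O, fderiv ℝ g x ≠ 0) {k : ℕ} {f : Bos m → ℝ} (hf : IsCkSupp k O f) :
    ContDiff ℝ (k + 1) (sublevel g f) := by
  induction k generalizing f with
  | zero => simpa using contDiff_sublevel_zero hg hO hreg (by simpa using hf)
  | succ k ih =>
    obtain ⟨V, hV, rfl⟩ := hf.exists_alongDeriv_eq hg hO hreg (natCast_le_infty _)
    have hV1 (i) : IsCkSupp 1 O (V i) := (hV i).of_le (by simp)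
    rw [contDiff_succ_iff_deriv]
    refine ⟨fun t => (hasDerivAt_sublevel_alongDeriv hg hO hreg hV1 t).differentiableAt,
      by simp, ?_⟩
    rw [deriv_sublevel_alongDeriv hg hO hreg hV1]
    exact_mod_cast ih (IsCkSupp.divergence hV (by simp))

/-! ### The composed distributions `δ^{(j)}(g)` -/

/-- The value of `δ^{(j)}(g)` on functions with compact support in the regular set of `g`. -/
def deltaD (g : Bos m → ℝ) (j : ℕ) (f : Bos m → ℝ) : ℝ :=
  (-1) ^ j * iteratedDeriv (j + 1) (sublevel g f) 0

theorem deltaD_zero_alongDeriv (hg : ContDiff ℝ ∞ g) (hO : IsOpen O)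
    (hreg : ∀ x ∈ O, fderiv ℝ g x ≠ 0) {V : Fin m → Bos m → ℝ} (hV : ∀ i, IsCkSupp 1 O (V i)) :
    deltaD g 0 (alongDeriv V g) = sublevel g (divergence V) 0 := by
  simp [deltaD, iteratedDeriv_one, deriv_sublevel_alongDeriv hg hO hreg hV]

/-- The chain rule `V·∇(δ^{(j)}(g)) = δ^{(j+1)}(g) V·∇g` in dual form. Every induction on the order
below runs through it. -/
theorem deltaD_succ_alongDeriv (hg : ContDiff ℝ ∞ g) (hO : IsOpen O)
    (hreg : ∀ x ∈ O, fderiv ℝ g x ≠ 0) {V : Fin m → Bos m → ℝ} (hV : ∀ i, IsCkSupp 1 O (V i))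
    (j : ℕ) : deltaD g (j + 1) (alongDeriv V g) = -deltaD g j (divergence V) := by
  rw [deltaD, iteratedDeriv_succ', deriv_sublevel_alongDeriv hg hO hreg hV, deltaD, pow_succ]
  ring

theorem deltaD_add (hg : ContDiff ℝ ∞ g) (hO : IsOpen O) (hreg : ∀ x ∈ O, fderiv ℝ g x ≠ 0)
    {j : ℕ} {f f' : Bos m → ℝ} (hf : IsCkSupp j O f) (hf' : IsCkSupp j O f') :
    deltaD g j (fun x => f x + f' x) = deltaD g j f + deltaD g j f' := by
  have hc {f : Bos m → ℝ} (hf : IsCkSupp j O f) : ContDiffAt ℝ (j + 1 : ℕ) (sublevel g f) 0 :=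
    mod_cast (contDiff_sublevel hg hO hreg hf).contDiffAt
  rw [deltaD, funext (sublevel_add (hf.of_le (by simp)) (hf'.of_le (by simp))),
    iteratedDeriv_fun_add (hc hf) (hc hf'), mul_add]
  rfl

theorem deltaD_const_mul (j : ℕ) (c : ℝ) (f : Bos m → ℝ) :
    deltaD g j (fun x => c * f x) = c * deltaD g j f := by
  rw [deltaD, funext (sublevel_const_mul c f), iteratedDeriv_const_mul_field, deltaD]
  ring

theorem deltaD_zero_fun (j : ℕ) : deltaD g j (fun _ => 0) = 0 := by
  simpa using deltaD_const_mul (g := g) j 0 (fun _ => 0)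

theorem deltaD_sum (hg : ContDiff ℝ ∞ g) (hO : IsOpen O) (hreg : ∀ x ∈ O, fderiv ℝ g x ≠ 0)
    {j : ℕ} {ι : Type*} (s : Finset ι) {F : ι → Bos m → ℝ} (hF : ∀ i ∈ s, IsCkSupp j O (F i)) :
    deltaD g j (fun x => ∑ i ∈ s, F i x) = ∑ i ∈ s, deltaD g j (F i) := by
  classical
  induction s using Finset.induction_on with
  | empty => simpa using deltaD_zero_fun j
  | insert a s ha ih =>
    have h1 := hF a (Finset.mem_insert_self a s)
    have h2 : ∀ i ∈ s, IsCkSupp j O (F i) := fun i hi => hF i (Finset.mem_insert_of_mem hi)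
    simp only [Finset.sum_insert ha]
    rw [deltaD_add hg hO hreg h1 (IsCkSupp.sum s h2), ih h2]

theorem alongDeriv_mul_left (a : Bos m → ℝ) (V : Fin m → Bos m → ℝ) (g : Bos m → ℝ) :
    alongDeriv (fun i x => a x * V i x) g = fun x => a x * alongDeriv V g x := by
  ext x
  simp [alongDeriv, Finset.mul_sum, mul_assoc]

theorem divergence_mul_left {a : Bos m → ℝ} {V : Fin m → Bos m → ℝ} (ha : Differentiable ℝ a)
    (hV : ∀ i, Differentiable ℝ (V i)) :
    divergence (fun i x => a x * V i x) = fun x => a x * divergence V x + alongDeriv V a x := by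
  ext x
  simp only [divergence, alongDeriv, Finset.mul_sum, ← Finset.sum_add_distrib]
  exact Finset.sum_congr rfl fun i _ => pderiv_mul (ha x) (hV i x) i

/-- Put `S(t) = ∫_{g<t} f` and let `R` be its antiderivative `ramp g f`. Then `∫_{g<t} g f = t S(t)
- R(t)`, whose derivative `t S'(t)` vanishes at zero. -/
theorem deltaD_zero_mul_self (hg : ContDiff ℝ ∞ g) (hO : IsOpen O)
    (hreg : ∀ x ∈ O, fderiv ℝ g x ≠ 0) {f : Bos m → ℝ} (hf : IsCkSupp 0 O f) :
    deltaD g 0 (fun x => g x * f x) = 0 := by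
  have hgc := hg.continuous
  have hgf : IsCkSupp 0 O (fun x => g x * f x) := hf.mul_left (hg.of_le (by simp))
  have key (t : ℝ) : sublevel g (fun x => g x * f x) t = t * sublevel g f t - ramp g f t := by
    have h1 : ramp g f t = ∫ x in {x | g x < t}, (t * f x - g x * f x) := by
      rw [← integral_indicator (measurableSet_sublevel hg t), ramp]
      congr 1 with x
      by_cases hx : g x < t
      · rw [indicator_of_mem (show x ∈ {x | g x < t} from hx), max_eq_left (by linarith)]
        ring
      · rw [indicator_of_notMem (show x ∉ {x | g x < t} from hx),
          max_eq_right (by linarith [not_lt.1 hx]), zero_mul]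
    rw [h1, integral_sub (hf.const_mul t).integrable.integrableOn hgf.integrable.integrableOn,
      integral_const_mul, sublevel, sublevel]
    ring
  have hd : HasDerivAt (sublevel g fun x => g x * f x) 0 0 := by
    rw [funext key]
    have h1 := ((contDiff_sublevel_zero hg hO hreg hf).differentiable (by simp) 0).hasDerivAt
    have h2 := ((hasDerivAt_id (0 : ℝ)).mul h1).sub (hasDerivAt_ramp hg hO hreg hf 0)
    exact HasDerivAt.congr_deriv (f := fun t => t * sublevel g f t - ramp g f t) h2 (by simp)
  simp [deltaD, iteratedDeriv_one, hd.deriv]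

/-- The relation `g δ^{(j+1)}(g) = -(j+1) δ^{(j)}(g)`. -/
theorem deltaD_succ_mul_self (hg : ContDiff ℝ ∞ g) (hO : IsOpen O)
    (hreg : ∀ x ∈ O, fderiv ℝ g x ≠ 0) {j : ℕ} {f : Bos m → ℝ}
    (hf : IsCkSupp (j + 1 : ℕ) O f) :
    deltaD g (j + 1) (fun x => g x * f x) = -(j + 1) * deltaD g j f := by
  have hg1 : Differentiable ℝ g := hg.differentiable (by simp)
  induction j generalizing f with
  | zero =>
    obtain ⟨V, hV, rfl⟩ := hf.exists_alongDeriv_eq hg hO hreg (by simp)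
    have hV1 (i) : IsCkSupp 1 O (V i) := (hV i).of_le (by simp)
    have hdiv : IsCkSupp 0 O (divergence V) := IsCkSupp.divergence hV1 (by simp)
    rw [← alongDeriv_mul_left, deltaD_succ_alongDeriv hg hO hreg
      fun i => (hV1 i).mul_left (hg.of_le (by simp)),
      divergence_mul_left hg1 fun i => (hV1 i).contDiff.differentiable (by simp),
      deltaD_add hg hO hreg (hdiv.mul_left (hg.of_le (by simp))) (hf.of_le (by simp)),
      deltaD_zero_mul_self hg hO hreg hdiv]
    simp
  | succ j ih =>
    -- With `f = V·∇g` one has `g f = (gV)·∇g` and `div(gV) = g div V + f`; the first summand falls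
    -- under the induction hypothesis, the second adds one to the factor.
    obtain ⟨V, hV, rfl⟩ := hf.exists_alongDeriv_eq hg hO hreg (natCast_le_infty _)
    have hV1 (i) : IsCkSupp 1 O (V i) := (hV i).of_le (by simp)
    have hdiv : IsCkSupp (j + 1 : ℕ) O (divergence V) :=
      IsCkSupp.divergence hV (by simp)
    rw [← alongDeriv_mul_left, deltaD_succ_alongDeriv hg hO hreg
      fun i => (hV1 i).mul_left (hg.of_le (by simp)),
      divergence_mul_left hg1 fun i => (hV1 i).contDiff.differentiable (by simp),
      deltaD_add hg hO hreg (hdiv.mul_left (hg.of_le (natCast_le_infty _))) (hf.of_le (by simp)),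
      ih hdiv, deltaD_succ_alongDeriv hg hO hreg hV1]
    push_cast
    ring

/-- Each factor `g` lowers the order by one and contributes minus the current order; the factors
multiply to a quotient of factorials. -/
theorem deltaD_add_pow_mul (hg : ContDiff ℝ ∞ g) (hO : IsOpen O)
    (hreg : ∀ x ∈ O, fderiv ℝ g x ≠ 0) {k i : ℕ} {f : Bos m → ℝ}
    (hf : IsCkSupp (k + i : ℕ) O f) :
    deltaD g (k + i) (fun x => g x ^ i * f x) =
      (-1) ^ i * ((k + i).factorial / k.factorial) * deltaD g k f := by
  induction i with
  | zero => simp [Nat.factorial_ne_zero]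
  | succ i ih =>
    have h1 : (fun x => g x ^ (i + 1) * f x) = fun x => g x * (g x ^ i * f x) := by
      ext x; ring
    have h2 := deltaD_succ_mul_self hg hO hreg (j := k + i)
      (hf.mul_left ((hg.pow i).of_le (natCast_le_infty _)))
    rw [h1, ← add_assoc, h2, ih (hf.of_le (by exact_mod_cast Nat.le_succ _)), Nat.factorial_succ]
    push_cast
    ring

end

end SuperSpace

/-! ### Scalar Dirac distributions: homogeneity under positive factors, and localisation -/

namespace SuperSpace

open MeasureTheory Filter Set

noncomputable section

variable {m : ℕ} {g : Bos m → ℝ} {O : Set (Bos m)}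

/-- By positivity `δ(g)` has order zero, so identities for smooth functions extend to continuous
ones. -/
theorem tendsto_deltaD_zero (hg : ContDiff ℝ ∞ g) (hO : IsOpen O)
    (hreg : ∀ x ∈ O, fderiv ℝ g x ≠ 0) {f ψ : Bos m → ℝ} {F : ℕ → Bos m → ℝ}
    (hf : IsCkSupp 0 O f) (hψ : IsCkSupp 0 O ψ) (hF : ∀ k, IsCkSupp 0 O (F k))
    (h : ∀ k x, |F k x - f x| ≤ 1 / ((k : ℝ) + 1) * ψ x) :
    Tendsto (fun k => deltaD g 0 (F k)) atTop (𝓝 (deltaD g 0 f)) := by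
  have hd {f : Bos m → ℝ} (hf : IsCkSupp 0 O f) : DifferentiableAt ℝ (sublevel g f) 0 :=
    (contDiff_sublevel_zero hg hO hreg hf).differentiable (by simp) 0
  refine tendsto_of_abs_sub_le (C := deriv (sublevel g ψ) 0) fun k => ?_
  have hsub := abs_deriv_sublevel_le ((hF k).sub hf) hψ (hd ((hF k).sub hf)) (hd hψ) (h k)
  rw [funext (sublevel_sub (hF k) hf), deriv_fun_sub (hd (hF k)) (hd hf)] at hsub
  simpa [deltaD, iteratedDeriv_one] using hsub

theorem alongDeriv_mul {a b : Bos m → ℝ} (ha : Differentiable ℝ a) (hb : Differentiable ℝ b)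
    (V : Fin m → Bos m → ℝ) :
    alongDeriv V (fun x => a x * b x) = fun x => a x * alongDeriv V b x + b x * alongDeriv V a x := by
  ext x
  simp only [alongDeriv, Finset.mul_sum, ← Finset.sum_add_distrib]
  refine Finset.sum_congr rfl fun i _ => ?_
  rw [pderiv_mul (ha x) (hb x) i]
  ring

theorem sublevel_mul_pos_zero {h : Bos m → ℝ} (hpos : ∀ x, 0 < h x) (f : Bos m → ℝ) :
    sublevel (fun x => h x * g x) f 0 = sublevel g f 0 := by
  have : {x | h x * g x < 0} = {x | g x < 0} := by
    ext x
    simp [mul_neg_iff, hpos x, (hpos x).le]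
  simp only [sublevel, this]

/-- Since `{hg < 0} = {g < 0}`, both `δ(g)(V·∇g)` and `δ(hg)(V·∇(hg))` equal the integral of `div V`
over this set. Here `V·∇(hg) = h V·∇g + g V·∇h`, and the last term is a multiple of `hg`, which
`δ(hg)` kills. -/
theorem deltaD_zero_mul_pos {h : Bos m → ℝ} (hg : ContDiff ℝ ∞ g) (hh : ContDiff ℝ ∞ h)
    (hpos : ∀ x, 0 < h x) (hO : IsOpen O) (hreg : ∀ x ∈ O, fderiv ℝ g x ≠ 0)
    (hreg' : ∀ x ∈ O, fderiv ℝ (fun x => h x * g x) x ≠ 0) {f : Bos m → ℝ}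
    (hf : IsCkSupp 0 O f) :
    deltaD (fun x => h x * g x) 0 (fun x => h x * f x) = deltaD g 0 f := by
  have hu : ContDiff ℝ ∞ (fun x => h x * g x) := hh.mul hg
  have key {f : Bos m → ℝ} (hf : IsCkSupp 1 O f) :
      deltaD (fun x => h x * g x) 0 (fun x => h x * f x) = deltaD g 0 f := by
    obtain ⟨V, hV, rfl⟩ := hf.exists_alongDeriv_eq hg hO hreg (by simp)
    have h1 := deltaD_zero_alongDeriv hu hO hreg' hV
    have hψ : IsCkSupp 0 O (alongDeriv V h) := (IsCkSupp.alongDeriv hV hh (by simp)).of_le (by simp)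
    rw [sublevel_mul_pos_zero hpos, ← deltaD_zero_alongDeriv hg hO hreg hV,
      alongDeriv_mul (hh.differentiable (by simp)) (hg.differentiable (by simp)),
      deltaD_add hu hO hreg' ((hf.mul_left (hh.of_le (by simp))).of_le (by simp))
        (hψ.mul_left (hg.of_le (by simp)))] at h1
    have h2 : (fun x => g x * alongDeriv V h x) =
        fun x => (h x * g x) * ((h x)⁻¹ * alongDeriv V h x) := by
      ext x
      field_simp [(hpos x).ne']
    have hinv : ContDiff ℝ 0 (fun x => (h x)⁻¹) := (hh.inv fun x => (hpos x).ne').of_le (by simp)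
    rwa [h2, deltaD_zero_mul_self hu hO hreg' (hψ.mul_left hinv), add_zero] at h1
  obtain ⟨ψ, F, hψ, hψ0, hF, hFf⟩ := hf.exists_approx hO
  have hh0 : ContDiff ℝ 0 h := hh.of_le (by simp)
  have hF0 (k) : IsCkSupp 0 O (F k) := (hF k).of_le (by simp)
  have l1 := tendsto_deltaD_zero hg hO hreg hf (hψ.of_le (by simp)) hF0 hFf
  have l2 := tendsto_deltaD_zero hu hO hreg' (hf.mul_left hh0) ((hψ.of_le (by simp)).mul_left hh0)
    (fun k => (hF0 k).mul_left hh0) fun k x => by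
      rw [← mul_sub, abs_mul, abs_of_pos (hpos x), mul_left_comm]
      exact mul_le_mul_of_nonneg_left (hFf k x) (hpos x).le
  simp only [fun k => key ((hF k).of_le (by simp))] at l2
  exact tendsto_nhds_unique l2 l1

/-- The homogeneity relation `h^{j+1} δ^{(j)}(h g) = δ^{(j)}(g)`. -/
theorem deltaD_mul_pos {h : Bos m → ℝ} (hg : ContDiff ℝ ∞ g) (hh : ContDiff ℝ ∞ h)
    (hpos : ∀ x, 0 < h x) (hO : IsOpen O) (hreg : ∀ x ∈ O, fderiv ℝ g x ≠ 0)
    (hreg' : ∀ x ∈ O, fderiv ℝ (fun x => h x * g x) x ≠ 0) {j : ℕ} {f : Bos m → ℝ}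
    (hf : IsCkSupp j O f) :
    deltaD (fun x => h x * g x) j (fun x => h x ^ (j + 1) * f x) = deltaD g j f := by
  have hu : ContDiff ℝ ∞ (fun x => h x * g x) := hh.mul hg
  have hhd : Differentiable ℝ h := hh.differentiable (by simp)
  induction j generalizing f with
  | zero => simpa using deltaD_zero_mul_pos hg hh hpos hO hreg hreg' (by simpa using hf)
  | succ j ih =>
    obtain ⟨V, hV, rfl⟩ := hf.exists_alongDeriv_eq hg hO hreg (natCast_le_infty _)
    have hV1 (i) : IsCkSupp 1 O (V i) := (hV i).of_le (by simp)
    have hψ : IsCkSupp (j + 1 : ℕ) O (alongDeriv V h) :=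
      IsCkSupp.alongDeriv hV hh (natCast_le_infty _)
    have hψ' : IsCkSupp j O (alongDeriv V h) := hψ.of_le (by simp)
    have hdiv : IsCkSupp j O (divergence V) := IsCkSupp.divergence hV (by simp)
    have hpow (k l : ℕ) : ContDiff ℝ k (fun x => h x ^ l) := (hh.pow l).of_le (natCast_le_infty _)
    have hpd (l : ℕ) : Differentiable ℝ (fun x => h x ^ l) := hhd.pow l
    -- The chain rule for `hg` is applied to `h^{j+1} V`. On the left, `(hg) h^j V·∇h` contributes
    -- `-(j+1) δ^{(j)}(hg)(h^j V·∇h)`, which cancels the term on the right coming from the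
    -- derivative of `h^{j+1}`.
    have hW (i) : IsCkSupp 1 O (fun x => h x ^ (j + 1) * V i x) :=
      (hV1 i).mul_left (by exact_mod_cast hpow 1 (j + 1))
    have h1 := deltaD_succ_alongDeriv hu hO hreg' hW j
    rw [alongDeriv_mul_left, alongDeriv_mul hhd (hg.differentiable (by simp)),
      divergence_mul_left (hpd _) fun i => (hV1 i).contDiff.differentiable (by simp)] at h1
    have h2 : alongDeriv V (fun x => h x ^ (j + 1)) =
        fun x => ((j : ℝ) + 1) * (h x ^ j * alongDeriv V h x) := by
      ext x
      have (i : Fin m) : pderiv i (fun x => h x ^ (j + 1)) x =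
          (j + 1) * h x ^ j * pderiv i h x := by
        simp [pderiv, fderiv_fun_pow _ (hhd x), mul_assoc]
      simp only [alongDeriv, this, Finset.mul_sum]
      exact Finset.sum_congr rfl fun i _ => by ring
    have h3 : (fun x => h x ^ (j + 1) * (h x * alongDeriv V g x + g x * alongDeriv V h x)) =
        fun x => h x ^ (j + 1 + 1) * alongDeriv V g x +
          (h x * g x) * (h x ^ j * alongDeriv V h x) := by
      ext x
      ring
    rw [h2, h3, deltaD_add hu hO hreg' (hdiv.mul_left (hpow _ _))
        ((hψ'.mul_left (hpow _ _)).const_mul _), deltaD_const_mul,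
      deltaD_add hu hO hreg' (hf.mul_left (hpow _ _))
        ((hψ.mul_left (hpow _ _)).mul_left (hu.of_le (natCast_le_infty _))),
      deltaD_succ_mul_self hu hO hreg' (hψ.mul_left (hpow _ _)), ih hdiv] at h1
    rw [deltaD_succ_alongDeriv hg hO hreg hV1]
    linarith

/-! ### Localisation -/

/-- For small `ε` the cutoff is one on the `ε`-neighbourhood. On the rest of the support of `χf`,
`g` stays away from zero, so that region contributes a constant for small `t`, and derivatives in
`t` do not see it. -/
theorem hasDeltaPairing_of_bump {χ f : Bos m → ℝ} {j : ℕ} (hg : ContDiff ℝ ∞ g) (hO : IsOpen O)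
    (hreg : ∀ x ∈ O, fderiv ℝ g x ≠ 0) (hχ : HasCompactSupport χ)
    (hχf : IsCkSupp j O (fun x => χ x * f x))
    (h1 : ∀ x, g x = 0 → x ∈ tsupport f → ∀ᶠ y in 𝓝 x, χ y = 1) :
    HasDeltaPairing g j f (deltaD g j fun x => χ x * f x) := by
  set K : Set (Bos m) := {x | g x = 0} ∩ tsupport f with hKdef
  have hK : IsCompact K := by
    refine hχ.of_isClosed_subset
      ((isClosed_eq hg.continuous continuous_const).inter (isClosed_tsupport f)) fun x hx => ?_
    refine subset_tsupport χ ?_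
    rw [Function.mem_support, (h1 x hx.1 hx.2).self_of_nhds]
    exact one_ne_zero
  obtain ⟨δ, hδ, hδW⟩ := hK.exists_thickening_subset_open (t := interior {x | χ x = 1})
    isOpen_interior fun x hx => mem_interior_iff_mem_nhds.2 (h1 x hx.1 hx.2)
  filter_upwards [Ioo_mem_nhdsGT hδ] with ε hε
  have hN1 : ∀ x ∈ nearZero g f ε, χ x = 1 := fun x hx =>
    interior_subset (s := {x | χ x = 1}) (hδW (Metric.thickening_mono hε.2.le _ hx))
  have hNo : IsOpen (nearZero g f ε) := Metric.isOpen_thickening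
  have hEq : EqOn (fun x => χ x * f x) f (nearZero g f ε) := fun x hx => by simp [hN1 x hx]
  -- `c` is a positive lower bound of `|g|` on a compact set that misses `g = 0`. For `|t| < c` the
  -- conditions `g < t` and `g < 0` agree there.
  obtain ⟨c, hc, hcC⟩ : ∃ c > 0, ∀ x, x ∈ tsupport (fun x => χ x * f x) → x ∉ nearZero g f ε →
      c ≤ |g x| := by
    obtain ⟨c, hc, h⟩ := (hχf.hasCompactSupport.isCompact.diff hNo).exists_forall_le'
      (f := fun x => |g x|) (a := 0) hg.continuous.abs.continuousOn fun x hx => by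
        refine abs_pos.2 fun h0 => hx.2 ?_
        exact Metric.self_subset_thickening hε.1 _ ⟨h0, tsupport_mul_subset_right hx.1⟩
    exact ⟨c, hc, fun x hx hx' => h x ⟨hx, hx'⟩⟩
  set r : ℝ := ∫ x in {x | g x < 0} \ nearZero g f ε, χ x * f x
  have hloc : sublevelIntegral g f ε =ᶠ[𝓝 0] fun t => sublevel g (fun x => χ x * f x) t - r := by
    filter_upwards [Ioo_mem_nhds (neg_lt_zero.2 hc) hc] with t ht
    have hms := measurableSet_sublevel hg t
    have hr : r = ∫ x in {x | g x < t} \ nearZero g f ε, χ x * f x := by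
      simp only [r]
      rw [← integral_indicator ((measurableSet_sublevel hg 0).diff hNo.measurableSet),
        ← integral_indicator (hms.diff hNo.measurableSet)]
      congr 1 with x
      by_cases hx : x ∈ tsupport (fun x => χ x * f x) ∧ x ∉ nearZero g f ε
      · have hcx := hcC x hx.1 hx.2
        have : (g x < 0) ↔ g x < t := by
          rcases abs_cases (g x) with h | h
          · constructor <;> intro <;> linarith [ht.1, ht.2]
          · constructor <;> intro <;> linarith [ht.1, ht.2]
        have e : x ∈ {x | g x < 0} \ nearZero g f ε ↔ x ∈ {x | g x < t} \ nearZero g f ε :=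
          and_congr_left' this
        by_cases hx0 : x ∈ {x | g x < 0} \ nearZero g f ε
        · rw [indicator_of_mem hx0, indicator_of_mem (e.1 hx0)]
        · rw [indicator_of_notMem hx0, indicator_of_notMem fun h => hx0 (e.2 h)]
      · rw [not_and_or, not_not] at hx
        rcases hx with hx | hx
        · have : χ x * f x = 0 := image_eq_zero_of_notMem_tsupport (f := fun x => χ x * f x) hx
          simp [indicator, this]
        · simp [indicator, hx]
    have hsplit := setIntegral_union (μ := volume) (f := fun x => χ x * f x)
      (s := nearZero g f ε ∩ {x | g x < t}) (t := {x | g x < t} \ nearZero g f ε)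
      (disjoint_left.2 fun x hx hx' => hx'.2 hx.1) (hms.diff hNo.measurableSet)
      hχf.integrable.integrableOn hχf.integrable.integrableOn
    rw [inter_comm, inter_union_sdiff, inter_comm] at hsplit
    rw [sublevel, hsplit, ← hr, add_sub_cancel_right, sublevelIntegral]
    exact (setIntegral_congr_fun (hNo.measurableSet.inter hms) fun x hx => hEq hx.1).symm
  refine ⟨hχf.integrable.integrableOn.congr_fun hEq hNo.measurableSet, ?_, ?_⟩
  · exact ((contDiff_sublevel hg hO hreg hχf).contDiffAt.sub contDiffAt_const).congr_of_eventuallyEq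
      hloc
  -- At least one derivative is taken, so the constant `r` drops out.
  · rw [hloc.iteratedDeriv_eq, deltaD, iteratedDeriv_succ', iteratedDeriv_succ']
    simp only [deriv_sub_const_fun]

end

end SuperSpace

namespace SuperSpace

noncomputable section

variable {n : ℕ}

/-! ### The Grassmann algebra -/

/-- The even part of the Grassmann algebra. -/
abbrev evenGr (n : ℕ) : Subalgebra ℝ (Grassmann n) :=
  CliffordAlgebra.even (0 : QuadraticForm ℝ (Fin (2 * n) → ℝ))

/-- The odd part of the Grassmann algebra. -/
abbrev oddGr (n : ℕ) : Submodule ℝ (Grassmann n) :=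
  CliffordAlgebra.evenOdd (0 : QuadraticForm ℝ (Fin (2 * n) → ℝ)) 1

/-- The canonical embedding of the generators. -/
abbrev vec (v : Fin (2 * n) → ℝ) : Grassmann n := ExteriorAlgebra.ι ℝ v

theorem vec_mul_vec (v w : Fin (2 * n) → ℝ) : vec v * vec w = -(vec w * vec v) :=
  eq_neg_of_add_eq_zero_left (ExteriorAlgebra.ι_add_mul_swap v w)

@[elab_as_elim]
theorem evenGr_induction {P : ∀ a, a ∈ evenGr n → Prop}
    (scalar : ∀ r : ℝ, P (algebraMap ℝ _ r) (Subalgebra.algebraMap_mem _ _))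
    (add : ∀ a b ha hb, P a ha → P b hb → P (a + b) (Subalgebra.add_mem _ ha hb))
    (mul : ∀ v w a ha (hb : vec v * vec w * a ∈ evenGr n), P a ha → P (vec v * vec w * a) hb)
    (a : Grassmann n) (ha : a ∈ evenGr n) : P a ha :=
  CliffordAlgebra.even_induction (Q := (0 : QuadraticForm ℝ (Fin (2 * n) → ℝ)))
    (motive := P) scalar add (fun v w a ha => mul v w a ha _) a ha

/-- A product of two generators passes every generator with two sign changes, so even elements are
central. -/
theorem even_mul_comm {a : Grassmann n} (ha : a ∈ evenGr n) (b : Grassmann n) : a * b = b * a := by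
  induction a, ha using evenGr_induction with
  | scalar r => exact Algebra.commutes r b
  | add a a' _ _ h h' => rw [add_mul, mul_add, h, h']
  | mul v w a _ _ h =>
    have hvw : vec v * vec w * b = b * (vec v * vec w) := by
      clear h
      induction b using ExteriorAlgebra.induction with
      | algebraMap r => exact (Algebra.commutes r _).symm
      | ι u =>
        change vec v * vec w * vec u = vec u * (vec v * vec w)
        rw [mul_assoc, vec_mul_vec w u, mul_neg, ← mul_assoc, vec_mul_vec v u]
        simp [mul_assoc]
      | mul b c hb hc => rw [← mul_assoc, hb, mul_assoc, hc, mul_assoc]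
      | add b c hb hc => rw [mul_add, hb, hc, add_mul]
    rw [mul_assoc, h, ← mul_assoc, hvw, mul_assoc]

theorem odd_mul_odd {a b : Grassmann n} (ha : a ∈ oddGr n) (hb : b ∈ oddGr n) :
    a * b ∈ evenGr n := by
  have := SetLike.mul_mem_graded (A := CliffordAlgebra.evenOdd
    (0 : QuadraticForm ℝ (Fin (2 * n) → ℝ))) ha hb
  rwa [show (1 : ZMod 2) + 1 = 0 from rfl] at this

theorem even_mul_odd {a b : Grassmann n} (ha : a ∈ evenGr n) (hb : b ∈ oddGr n) :
    a * b ∈ oddGr n := by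
  have := SetLike.mul_mem_graded (A := CliffordAlgebra.evenOdd
    (0 : QuadraticForm ℝ (Fin (2 * n) → ℝ))) (i := 0) ha hb
  rwa [zero_add] at this

theorem grDeriv_vec_mul (j : Fin (2 * n)) (v : Fin (2 * n) → ℝ) (c : Grassmann n) :
    grDeriv j (vec v * c) = v j • c - vec v * grDeriv j c := by
  have h : grDeriv j (vec v * c) =
      (LinearMap.proj j : (Fin (2 * n) → ℝ) →ₗ[ℝ] ℝ) v • c - vec v * grDeriv j c := by
    unfold grDeriv
    exact CliffordAlgebra.contractLeft_ι_mul (Q := (0 : QuadraticForm ℝ (Fin (2 * n) → ℝ)))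
      (d := (LinearMap.proj j : (Fin (2 * n) → ℝ) →ₗ[ℝ] ℝ)) v c
  rw [h, LinearMap.proj_apply]

/-- The Leibniz rule for products with even elements. -/
theorem grDeriv_mul (j : Fin (2 * n)) {a : Grassmann n} (ha : a ∈ evenGr n) (b : Grassmann n) :
    grDeriv j (a * b) = grDeriv j a * b + a * grDeriv j b := by
  have h1 := grDeriv_vec_mul (n := n) j
  induction a, ha using evenGr_induction with
  | scalar r =>
    simp only [grDeriv]
    rw [CliffordAlgebra.contractLeft_algebraMap_mul, CliffordAlgebra.contractLeft_algebraMap,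
      zero_mul, zero_add]
  | add a a' _ _ h h' => rw [add_mul, map_add, h, h', map_add, add_mul, add_mul]; abel
  | mul v w a _ _ h =>
    rw [mul_assoc, mul_assoc, h1, h1, mul_assoc, h1, h1, h]
    simp only [mul_sub, sub_mul, mul_add, smul_mul_assoc, mul_smul_comm, mul_assoc]
    abel

theorem grDeriv_mem_odd (j : Fin (2 * n)) {a : Grassmann n} (ha : a ∈ evenGr n) :
    grDeriv j a ∈ oddGr n := by
  have h1 := grDeriv_vec_mul (n := n) j
  have hv (v : Fin (2 * n) → ℝ) : vec v ∈ oddGr n :=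
    CliffordAlgebra.ι_mem_evenOdd_one _ _
  induction a, ha using evenGr_induction with
  | scalar r =>
    rw [grDeriv, CliffordAlgebra.contractLeft_algebraMap]
    exact Submodule.zero_mem _
  | add a a' _ _ h h' => rw [map_add]; exact Submodule.add_mem _ h h'
  | mul v w a ha _ h =>
    have hva (v : Fin (2 * n) → ℝ) : vec v * a ∈ oddGr n := by
      rw [← even_mul_comm ha]
      exact even_mul_odd ha (hv v)
    rw [mul_assoc, h1, h1, mul_sub, ← mul_assoc, mul_smul_comm]
    exact Submodule.sub_mem _ (Submodule.smul_mem _ _ (hva w))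
      (Submodule.sub_mem _ (Submodule.smul_mem _ _ (hva v))
      (even_mul_odd (odd_mul_odd (hv v) (hv w)) h))

/-! ### Body and nilpotent part -/

/-- The body as an algebra homomorphism. -/
def bodyHom (n : ℕ) : Grassmann n →ₐ[ℝ] ℝ := ExteriorAlgebra.algebraMapInv

theorem body_eq (a : Grassmann n) : body a = bodyHom n a := rfl

@[simp] theorem bodyHom_algebraMap (r : ℝ) : bodyHom n (algebraMap ℝ _ r) = r :=
  (bodyHom n).commutes r

@[simp] theorem bodyHom_vec (v : Fin (2 * n) → ℝ) : bodyHom n (vec v) = 0 := by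
  simp [bodyHom, ExteriorAlgebra.algebraMapInv]

theorem body_mul (a b : Grassmann n) : body (a * b) = body a * body b :=
  map_mul (bodyHom n) a b

theorem body_odd {a : Grassmann n} (ha : a ∈ oddGr n) : body a = 0 := by
  rw [body_eq]
  induction a, ha using CliffordAlgebra.odd_induction with
  | ι v => exact bodyHom_vec v
  | add a b _ _ h h' => rw [map_add, h, h', add_zero]
  | ι_mul_ι_mul v w a _ h => rw [map_mul, h, mul_zero]

@[simp] theorem body_nil (a : Grassmann n) : body (nil a) = 0 := by
  simp [nil, body_eq]

theorem nil_mem_even {a : Grassmann n} (ha : a ∈ evenGr n) : nil a ∈ evenGr n :=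
  Subalgebra.sub_mem _ ha (Subalgebra.algebraMap_mem _ _)

theorem eq_body_add_nil (a : Grassmann n) : a = algebraMap ℝ _ (body a) + nil a := by
  simp [nil]

/-- The elements of degree at least `k`. -/
def degGe (n k : ℕ) : Submodule ℝ (Grassmann n) :=
  LinearMap.range (ExteriorAlgebra.ι ℝ (M := Fin (2 * n) → ℝ)) ^ k * ⊤

/-- Vectors can be moved to the left past anything, so the one-sided ideal `degGe` is two-sided and
degrees add under multiplication. -/
theorem top_mul_range_pow_le (n k : ℕ) :
    ⊤ * LinearMap.range (ExteriorAlgebra.ι ℝ (M := Fin (2 * n) → ℝ)) ^ k ≤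
      LinearMap.range (ExteriorAlgebra.ι ℝ (M := Fin (2 * n) → ℝ)) ^ k * ⊤ := by
  have h1 : ⊤ * LinearMap.range (ExteriorAlgebra.ι ℝ (M := Fin (2 * n) → ℝ)) ≤
      LinearMap.range (ExteriorAlgebra.ι ℝ (M := Fin (2 * n) → ℝ)) * ⊤ := by
    refine Submodule.mul_le.2 fun a _ b hb => ?_
    obtain ⟨v, rfl⟩ := hb
    induction a using ExteriorAlgebra.induction generalizing v with
    | algebraMap r =>
      rw [Algebra.commutes]
      exact Submodule.mul_mem_mul ⟨v, rfl⟩ trivial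
    | ι w =>
      change vec w * vec v ∈ _
      rw [vec_mul_vec, ← mul_neg]
      exact Submodule.mul_mem_mul ⟨v, rfl⟩ trivial
    | add a b ha hb =>
      rw [add_mul]
      exact Submodule.add_mem _ (ha trivial v) (hb trivial v)
    | mul a b ha hb =>
      rw [mul_assoc]
      refine Submodule.mul_induction_on (hb trivial v) (fun x hx y _ => ?_) fun x y hx hy => ?_
      · obtain ⟨w, rfl⟩ := hx
        rw [← mul_assoc]
        have := Submodule.mul_mem_mul (ha trivial w) (Submodule.mem_top (x := y) (R := ℝ))
        rw [mul_assoc (LinearMap.range _)] at this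
        exact (mul_le_mul' le_rfl le_top :
          LinearMap.range (ExteriorAlgebra.ι ℝ (M := Fin (2 * n) → ℝ)) * (⊤ * ⊤) ≤ _) this
      · rw [mul_add]
        exact Submodule.add_mem _ hx hy
  induction k with
  | zero => simp
  | succ k ih =>
    calc _ ≤ LinearMap.range (ExteriorAlgebra.ι ℝ (M := Fin (2 * n) → ℝ)) ^ k *
          (⊤ * LinearMap.range (ExteriorAlgebra.ι ℝ (M := Fin (2 * n) → ℝ))) := by
          rw [pow_succ, ← mul_assoc, ← mul_assoc]
          exact mul_le_mul' ih le_rfl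
      _ ≤ _ := by
          rw [pow_succ, mul_assoc]
          exact mul_le_mul' le_rfl h1

theorem mul_mem_degGe {k l : ℕ} {a b : Grassmann n} (ha : a ∈ degGe n k) (hb : b ∈ degGe n l) :
    a * b ∈ degGe n (k + l) := by
  have h := Submodule.mul_mem_mul ha hb
  have hle : degGe n k * degGe n l ≤ degGe n (k + l) := by
    rw [degGe, degGe, degGe, pow_add, mul_assoc, mul_assoc, ← mul_assoc ⊤]
    refine mul_le_mul' le_rfl ((mul_le_mul'
      (top_mul_range_pow_le n l) le_rfl).trans ?_)
    rw [mul_assoc]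
    exact mul_le_mul' le_rfl le_top
  exact hle h

theorem eq_zero_of_mem_degGe {k : ℕ} (hk : 2 * n < k) {a : Grassmann n} (ha : a ∈ degGe n k) :
    a = 0 := by
  have h : LinearMap.range (ExteriorAlgebra.ι ℝ (M := Fin (2 * n) → ℝ)) ^ k = ⊥ := by
    have := exteriorPower.finrank_eq (R := ℝ) (M := Fin (2 * n) → ℝ) (n := k)
    rw [Module.finrank_fin_fun, Nat.choose_eq_zero_of_lt hk] at this
    exact Submodule.finrank_eq_zero.1 this
  rw [degGe, h, Submodule.bot_mul] at ha
  exact ha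

theorem even_mem_degGe_two {a : Grassmann n} (ha : a ∈ evenGr n) (h0 : body a = 0) :
    a ∈ degGe n 2 := by
  have h : a - algebraMap ℝ _ (body a) ∈ degGe n 2 := by
    clear h0
    simp only [body_eq]
    induction a, ha using evenGr_induction with
    | scalar r => simp
    | add a b _ _ h h' =>
      have := Submodule.add_mem _ h h'
      rw [map_add, map_add]
      convert this using 1
      abel
    | mul v w a _ _ _ =>
      simp only [map_mul, bodyHom_vec, zero_mul, map_zero, sub_zero]
      rw [degGe, pow_two]
      exact Submodule.mul_mem_mul (Submodule.mul_mem_mul ⟨v, rfl⟩ ⟨w, rfl⟩) trivial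
  simpa [h0] using h

theorem pow_mem_degGe {a : Grassmann n} (ha : a ∈ evenGr n) (h0 : body a = 0) (k : ℕ) :
    a ^ k ∈ degGe n (2 * k) := by
  induction k with
  | zero => simp [degGe]
  | succ k ih =>
    rw [pow_succ]
    exact mul_mem_degGe ih (even_mem_degGe_two ha h0)

/-- Even elements without body have degree at least two, so the product has degree at least `2(k +
l)`, beyond the top degree `2n`. This is why all expansions stop at `n`. -/
theorem pow_mul_pow_eq_zero {a b : Grassmann n} (ha : a ∈ evenGr n) (ha0 : body a = 0)
    (hb : b ∈ evenGr n) (hb0 : body b = 0) {k l : ℕ} (hkl : n < k + l) : a ^ k * b ^ l = 0 :=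
  eq_zero_of_mem_degGe (k := 2 * k + 2 * l) (by omega)
    (mul_mem_degGe (pow_mem_degGe ha ha0 k) (pow_mem_degGe hb hb0 l))

theorem pow_eq_zero_of_even {a : Grassmann n} (ha : a ∈ evenGr n) (ha0 : body a = 0) {k : ℕ}
    (hk : n < k) : a ^ k = 0 := by
  simpa using pow_mul_pow_eq_zero ha ha0 (Subalgebra.zero_mem _) (by simp [body_eq]) (l := 0)
    (by simpa using hk)

/-! ### Powers -/

theorem choose_eq_ascPochhammer (p : ℝ) (j : ℕ) :
    Ring.choose p j = (-1) ^ j * (ascPochhammer ℝ j).eval (-p) / (j.factorial : ℝ) := by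
  have h := Ring.factorial_nsmul_multichoose_eq_ascPochhammer (-p) j
  rw [Polynomial.ascPochhammer_smeval_eq_eval] at h
  have hj : (j.factorial : ℝ) ≠ 0 := by positivity
  have h2 := Ring.choose_neg' (-p) j
  rw [neg_neg] at h2
  rw [eq_div_iff hj, ← h, h2, Units.smul_def, Int.coe_negOnePow_natCast, nsmul_eq_mul,
    zsmul_eq_mul]
  push_cast
  ring

/-- Evaluation of a power series, truncated in degree `n`. -/
def truncEval (n : ℕ) (A : PowerSeries ℝ) (x : Grassmann n) : Grassmann n :=
  Polynomial.aeval x (A.trunc (n + 1))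

theorem truncEval_eq_sum (A : PowerSeries ℝ) (x : Grassmann n) :
    truncEval n A x = ∑ j ∈ Finset.range (n + 1), PowerSeries.coeff j A • x ^ j := by
  rw [truncEval, Polynomial.aeval_def, PowerSeries.eval₂_trunc_eq_sum_range]
  simp [Algebra.smul_def]

theorem aeval_trunc_coe (p : Polynomial ℝ) {x : Grassmann n} (hx : x ^ (n + 1) = 0) :
    Polynomial.aeval x ((p : PowerSeries ℝ).trunc (n + 1)) = Polynomial.aeval x p := by
  induction p using Polynomial.induction_on' with
  | add p q hp hq => rw [Polynomial.coe_add, map_add, map_add, map_add, hp, hq]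
  | monomial k r =>
    by_cases hk : k < n + 1
    · rw [PowerSeries.trunc_coe_eq_self ((Polynomial.natDegree_monomial_le r).trans_lt hk)]
    · have h0 : x ^ k = 0 := pow_eq_zero_of_le (not_lt.1 hk) hx
      have : (Polynomial.monomial k r : PowerSeries ℝ).trunc (n + 1) = 0 := by
        ext i
        rw [PowerSeries.coeff_trunc, Polynomial.coeff_coe, Polynomial.coeff_monomial]
        split_ifs with h1 h2
        · omega
        · rfl
        · rfl
      rw [this, map_zero, Polynomial.aeval_monomial, h0, mul_zero]

/-- The terms lost by truncation vanish at `x`, so evaluation respects products and identities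
between power series carry over to Grassmann elements. -/
theorem truncEval_mul (A B : PowerSeries ℝ) {x : Grassmann n} (hx : x ^ (n + 1) = 0) :
    truncEval n (A * B) x = truncEval n A x * truncEval n B x := by
  rw [truncEval, truncEval, truncEval, ← map_mul, ← aeval_trunc_coe (_ * _) hx, Polynomial.coe_mul,
    PowerSeries.trunc_trunc_mul_trunc]

/-- Factoring out the body, `a^p = a₀^p (1 + 𝐚/a₀)^p` with a binomial series; the exponent laws are
then those of this series. -/
theorem grPow_eq_truncEval {a : Grassmann n} (ha0 : 0 < body a) (p : ℝ) :
    grPow a p = body a ^ p •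
      truncEval n (PowerSeries.binomialSeries ℝ p) ((body a)⁻¹ • nil a) := by
  rw [truncEval_eq_sum, Finset.smul_sum, grPow]
  refine Finset.sum_congr rfl fun j _ => ?_
  rw [PowerSeries.binomialSeries_coeff, choose_eq_ascPochhammer, smul_pow, smul_smul, smul_smul,
    Real.rpow_sub_natCast ha0.ne']
  congr 1
  simp only [smul_eq_mul, mul_one, inv_pow]
  ring

theorem nil_smul_pow_eq_zero {a : Grassmann n} (ha : a ∈ evenGr n) (c : ℝ) :
    (c • nil a) ^ (n + 1) = 0 := by
  rw [smul_pow, pow_eq_zero_of_even (nil_mem_even ha) (body_nil a) (Nat.lt_succ_self n), smul_zero]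

theorem grPow_add {a : Grassmann n} (ha : a ∈ evenGr n) (ha0 : 0 < body a) (p q : ℝ) :
    grPow a (p + q) = grPow a p * grPow a q := by
  rw [grPow_eq_truncEval ha0, grPow_eq_truncEval ha0, grPow_eq_truncEval ha0,
    PowerSeries.binomialSeries_add, truncEval_mul _ _ (nil_smul_pow_eq_zero ha _), smul_mul_smul_comm,
    Real.rpow_add ha0]

theorem grPow_zero {a : Grassmann n} (ha0 : 0 < body a) : grPow a 0 = 1 := by
  rw [grPow_eq_truncEval ha0, PowerSeries.binomialSeries_zero, truncEval, PowerSeries.trunc_one]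
  simp

theorem grPow_one {a : Grassmann n} (ha : a ∈ evenGr n) (ha0 : 0 < body a) : grPow a 1 = a := by
  have h : PowerSeries.binomialSeries ℝ (1 : ℝ) = ((1 + Polynomial.X : Polynomial ℝ) :) := by
    simpa using PowerSeries.binomialSeries_nat (R := ℝ) (A := ℝ) 1
  rw [grPow_eq_truncEval ha0, h, truncEval, aeval_trunc_coe _ (nil_smul_pow_eq_zero ha _)]
  conv_rhs => rw [eq_body_add_nil a]
  simp [smul_smul, ha0.ne', Algebra.algebraMap_eq_smul_one]

theorem grPow_natCast {a : Grassmann n} (ha : a ∈ evenGr n) (ha0 : 0 < body a) (k : ℕ) :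
    grPow a k = a ^ k := by
  induction k with
  | zero => simpa using grPow_zero ha0
  | succ k ih => rw [Nat.cast_succ, grPow_add ha ha0, ih, grPow_one ha ha0, pow_succ]

theorem grPow_neg_mul {a : Grassmann n} (ha : a ∈ evenGr n) (ha0 : 0 < body a) (p : ℝ) :
    grPow a (-p) * grPow a p = 1 := by
  rw [← grPow_add ha ha0, neg_add_cancel, grPow_zero ha0]

theorem grPow_half_mul_self {a : Grassmann n} (ha : a ∈ evenGr n) (ha0 : 0 < body a) :
    grPow a (1 / 2) * grPow a (1 / 2) = a := by
  rw [← grPow_add ha ha0, add_halves, grPow_one ha ha0]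

theorem grPow_mem_even {a : Grassmann n} (ha : a ∈ evenGr n) (p : ℝ) : grPow a p ∈ evenGr n :=
  Subalgebra.sum_mem _ fun _ _ => Subalgebra.smul_mem _ (Subalgebra.pow_mem _ (nil_mem_even ha) _) _

theorem body_grPow {a : Grassmann n} (p : ℝ) : body (grPow a p) = body a ^ p := by
  have h : bodyHom n (nil a) = 0 := body_nil a
  rw [grPow, body_eq, map_sum, Finset.sum_eq_single 0]
  · simp
  · intro j _ hj
    rw [map_smul, map_pow, h, zero_pow hj, smul_zero]
  · simp

/-- The expansion of `a^{-(k+1)}`. -/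
theorem grPow_neg_succ (a : Grassmann n) (k : ℕ) :
    grPow a (-((k : ℝ) + 1)) = ∑ i ∈ Finset.range (n + 1),
      ((-1) ^ i * ((k + i).choose i : ℝ) * body a ^ (-((k : ℝ) + 1) - i)) • nil a ^ i := by
  rw [grPow]
  refine Finset.sum_congr rfl fun i _ => ?_
  congr 1
  have h : (ascPochhammer ℝ i).eval ((k : ℝ) + 1) = i.factorial * ((k + i).choose i : ℝ) := by
    have := ascPochhammer_nat_eq_ascFactorial (k + 1) i
    rw [← Nat.cast_succ, ← ascPochhammer_eval_cast, this, Nat.ascFactorial_eq_factorial_mul_choose]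
    push_cast
    rfl
  rw [neg_neg, h]
  field_simp

end

end SuperSpace

namespace SuperSpace

open Set

noncomputable section

variable {m n : ℕ}

/-! ### Regularity of superfunctions -/

/-- The coefficients of `F` are of class `C^k` on `U`. -/
def IsCkOn (k : WithTop ℕ∞) (U : Set (Bos m)) (F : SuperFun m n) : Prop :=
  ∀ A, ContDiffOn ℝ k (coeff A F) U

/-- The coefficients of `F` are of class `C^k` with compact support in `O`. -/
def HasCkSupp (k : WithTop ℕ∞) (O : Set (Bos m)) (F : SuperFun m n) : Prop :=
  ∀ A, IsCkSupp k O (coeff A F)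

theorem linear_eq_sum (ℓ : Grassmann n →ₗ[ℝ] ℝ) (F : SuperFun m n) (x : Bos m) :
    ℓ (F x) = ∑ A, ℓ (monomialBasis n A) * coeff A F x := by
  have h := congrArg ℓ ((monomialBasis n).sum_repr (F x))
  rw [map_sum] at h
  rw [← h]
  exact Finset.sum_congr rfl fun A _ => by rw [map_smul, smul_eq_mul, mul_comm]; rfl

theorem coeff_eq (A : Finset (Fin (2 * n))) (F : SuperFun m n) :
    coeff A F = fun x => (monomialBasis n).coord A (F x) := rfl

/-- Expanding only the left factor leaves linear functionals of the right one, so regularity and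
derivatives of products reduce to scalar products. -/
theorem coeff_mul (A : Finset (Fin (2 * n))) (F G : SuperFun m n) (x : Bos m) :
    coeff A (F * G) x = ∑ B, coeff B F x *
      ((monomialBasis n).coord A ∘ₗ LinearMap.mulLeft ℝ (monomialBasis n B)) (G x) := by
  have h := linear_eq_sum ((monomialBasis n).coord A ∘ₗ LinearMap.mulRight ℝ (G x)) F x
  simp only [LinearMap.comp_apply, LinearMap.mulRight_apply] at h
  change (monomialBasis n).coord A (F x * G x) = _
  rw [h]
  simp [mul_comm]

namespace IsCkOn

variable {k l : WithTop ℕ∞} {U : Set (Bos m)} {F G : SuperFun m n}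

theorem linear (hF : IsCkOn k U F) (ℓ : Grassmann n →ₗ[ℝ] ℝ) :
    ContDiffOn ℝ k (fun x => ℓ (F x)) U := by
  simp only [linear_eq_sum]
  exact ContDiffOn.sum fun A _ => contDiffOn_const.mul (hF A)

theorem of_linear (h : ∀ ℓ : Grassmann n →ₗ[ℝ] ℝ, ContDiffOn ℝ k (fun x => ℓ (F x)) U) :
    IsCkOn k U F := fun A => h ((monomialBasis n).coord A)

theorem of_le (hF : IsCkOn l U F) (hkl : k ≤ l) : IsCkOn k U F := fun A => (hF A).of_le hkl

theorem mono {V : Set (Bos m)} (hF : IsCkOn k U F) (h : V ⊆ U) : IsCkOn k V F :=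
  fun A => (hF A).mono h

theorem congr (hF : IsCkOn k U F) (h : ∀ x ∈ U, G x = F x) : IsCkOn k U G :=
  fun A => (hF A).congr fun x hx => by simp [coeff, h x hx]

theorem map (hF : IsCkOn k U F) (T : Grassmann n →ₗ[ℝ] Grassmann n) :
    IsCkOn k U (fun x => T (F x)) := of_linear fun ℓ => hF.linear (ℓ ∘ₗ T)

theorem const (a : Grassmann n) : IsCkOn k U (fun _ => a) := of_linear fun _ => contDiffOn_const

theorem add (hF : IsCkOn k U F) (hG : IsCkOn k U G) : IsCkOn k U (F + G) :=
  of_linear fun ℓ => by simpa using (hF.linear ℓ).add (hG.linear ℓ)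

theorem sub (hF : IsCkOn k U F) (hG : IsCkOn k U G) : IsCkOn k U (F - G) :=
  of_linear fun ℓ => by simpa using (hF.linear ℓ).sub (hG.linear ℓ)

theorem mul (hF : IsCkOn k U F) (hG : IsCkOn k U G) : IsCkOn k U (F * G) := fun A => by
  rw [funext (coeff_mul A F G)]
  exact ContDiffOn.sum fun B _ => (hF B).mul (hG.linear _)

theorem smul {c : Bos m → ℝ} (hc : ContDiffOn ℝ k c U) (hF : IsCkOn k U F) :
    IsCkOn k U (fun x => c x • F x) :=
  of_linear fun ℓ => by simpa using hc.mul (hF.linear ℓ)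

theorem sum {ι : Type*} (s : Finset ι) {H : ι → SuperFun m n} (h : ∀ i ∈ s, IsCkOn k U (H i)) :
    IsCkOn k U (∑ i ∈ s, H i) :=
  of_linear fun ℓ => by
    simp only [Finset.sum_apply, map_sum]
    exact ContDiffOn.sum fun i hi => (h i hi).linear ℓ

theorem pow (hF : IsCkOn k U F) (j : ℕ) : IsCkOn k U (F ^ j) := by
  induction j with
  | zero => rw [pow_zero]; exact const 1
  | succ j ih => rw [pow_succ]; exact ih.mul hF

theorem body (hF : IsCkOn k U F) : ContDiffOn ℝ k (bodyFun F) U :=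
  hF.linear (bodyHom n).toLinearMap

theorem nil (hF : IsCkOn k U F) : IsCkOn k U (fun x => nil (F x)) := by
  have h := hF.sub (hF.map ((Algebra.linearMap ℝ (Grassmann n)) ∘ₗ (bodyHom n).toLinearMap))
  exact h

theorem grPow (hF : IsCkOn k U F) (h0 : ∀ x ∈ U, 0 < bodyFun F x) (p : ℝ) :
    IsCkOn k U (fun x => grPow (F x) p) := by
  have h := sum (k := k) (U := U) (Finset.range (n + 1)) (H := fun j x =>
    ((-1) ^ j * (ascPochhammer ℝ j).eval (-p) * bodyFun F x ^ (p - j) / (j.factorial : ℝ)) •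
      SuperSpace.nil (F x) ^ j) fun j _ => smul
      ((contDiffOn_const.mul (hF.body.rpow_const_of_ne fun x hx => (h0 x hx).ne')).div_const _)
      (hF.nil.pow j)
  refine h.congr fun x _ => ?_
  simp [SuperSpace.grPow, bodyFun, Finset.sum_apply]

end IsCkOn

theorem IsSmooth.isCkOn {F : SuperFun m n} (hF : IsSmooth F) (U : Set (Bos m)) : IsCkOn ∞ U F :=
  fun A => (hF A).contDiffOn

theorem IsCkOn.isSmooth {F : SuperFun m n} (hF : IsCkOn ∞ univ F) : IsSmooth F :=
  fun A => contDiffOn_univ.1 (hF A)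

theorem IsSmooth.linear {F : SuperFun m n} (hF : IsSmooth F) (ℓ : Grassmann n →ₗ[ℝ] ℝ) :
    ContDiff ℝ ∞ (fun x => ℓ (F x)) := contDiffOn_univ.1 ((hF.isCkOn univ).linear ℓ)

theorem IsSmooth.body {F : SuperFun m n} (hF : IsSmooth F) : ContDiff ℝ ∞ (bodyFun F) :=
  hF.linear (bodyHom n).toLinearMap

theorem IsSmooth.mul {F G : SuperFun m n} (hF : IsSmooth F) (hG : IsSmooth G) : IsSmooth (F * G) :=
  ((hF.isCkOn univ).mul (hG.isCkOn univ)).isSmooth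

theorem IsEven.mul {F G : SuperFun m n} (hF : IsEven F) (hG : IsEven G) : IsEven (F * G) :=
  fun x => Subalgebra.mul_mem _ (hF x) (hG x)

theorem HasCkSupp.linear {k : WithTop ℕ∞} {O : Set (Bos m)} {F : SuperFun m n}
    (hF : HasCkSupp k O F) (ℓ : Grassmann n →ₗ[ℝ] ℝ) : IsCkSupp k O (fun x => ℓ (F x)) := by
  simp only [linear_eq_sum]
  exact IsCkSupp.sum _ fun A _ => (hF A).const_mul _

theorem HasCkSupp.mul_left {k : WithTop ℕ∞} {O : Set (Bos m)} (hO : IsOpen O) {F G : SuperFun m n}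
    (hF : HasCkSupp k O F) (hG : IsCkOn k O G) : HasCkSupp k O (G * F) := fun A => by
  rw [funext (coeff_mul A G F)]
  exact IsCkSupp.sum _ fun B _ => (hF.linear _).mul_contDiffOn hO (hG B)

/-! ### The super gradient -/

/-- Reduces statements on bosonic derivatives to real-valued functions. -/
theorem linear_bosDeriv {F : SuperFun m n} (hF : IsSmooth F) (ℓ : Grassmann n →ₗ[ℝ] ℝ) (j : Fin m)
    (x : Bos m) : ℓ (bosDeriv j F x) = pderiv j (fun x => ℓ (F x)) x := by
  have hd (A) : DifferentiableAt ℝ (coeff A F) x := (hF A).differentiable (by simp) x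
  rw [funext (linear_eq_sum ℓ F), pderiv, fderiv_fun_sum fun A _ => (hd A).const_mul _]
  simp only [bosDeriv, map_sum, map_smul, smul_eq_mul, sum_apply]
  refine Finset.sum_congr rfl fun A _ => ?_
  rw [fderiv_const_mul (hd A), (hd A).lineDeriv_eq_fderiv]
  simp [mul_comm]

theorem IsSmooth.bosDeriv {F : SuperFun m n} (hF : IsSmooth F) (j : Fin m) :
    IsSmooth (bosDeriv j F) := fun A => by
  rw [coeff_eq]
  simp only [linear_bosDeriv hF]
  exact contDiff_pderiv (hF.linear _) (by simp) j

theorem bosDeriv_mul {F G : SuperFun m n} (hF : IsSmooth F) (hG : IsSmooth G) (j : Fin m) :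
    bosDeriv j (F * G) = bosDeriv j F * G + F * bosDeriv j G := by
  ext x
  refine (monomialBasis n).ext_elem fun A => ?_
  have h1 := linear_bosDeriv (hF.mul hG) ((monomialBasis n).coord A) j x
  have h2 : coeff A (bosDeriv j F * G + F * bosDeriv j G) x =
      coeff A (bosDeriv j F * G) x + coeff A (F * bosDeriv j G) x := by simp [coeff_eq]
  change coeff A (bosDeriv j (F * G)) x = coeff A (bosDeriv j F * G + F * bosDeriv j G) x
  rw [h2]
  refine h1.trans ?_
  have hdF (B) : DifferentiableAt ℝ (coeff B F) x := (hF B).differentiable (by simp) x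
  have hdG (ℓ : Grassmann n →ₗ[ℝ] ℝ) : DifferentiableAt ℝ (fun x => ℓ (G x)) x :=
    (hG.linear ℓ).differentiable (by simp) x
  change pderiv j (coeff A (F * G)) x = _
  rw [funext (coeff_mul A F G), pderiv, fderiv_fun_sum fun B _ => (hdF B).fun_mul (hdG _),
    coeff_mul, coeff_mul, ← Finset.sum_add_distrib, sum_apply]
  refine Finset.sum_congr rfl fun B _ => ?_
  have h3 := pderiv_mul (hdF B) (hdG ((monomialBasis n).coord A ∘ₗ
    LinearMap.mulLeft ℝ (monomialBasis n B))) j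
  rw [pderiv] at h3
  have h4 : coeff B (SuperSpace.bosDeriv j F) x = pderiv j (coeff B F) x :=
    linear_bosDeriv hF ((monomialBasis n).coord B) j x
  rw [h3, linear_bosDeriv hG, h4]
  ring

theorem IsEven.bosDeriv {F : SuperFun m n} (hF : IsSmooth F) (hev : IsEven F) (j : Fin m) :
    IsEven (bosDeriv j F) := by
  intro x
  by_contra hx
  -- A functional that kills the even part but not the derivative: composed with `F` it is
  -- identically zero, and so is its partial derivative.
  obtain ⟨ℓ, hℓ, hle⟩ := Submodule.exists_le_ker_of_notMem (p := (evenGr n).toSubmodule) hx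
  apply hℓ
  rw [linear_bosDeriv hF]
  have : (fun x => ℓ (F x)) = fun _ => 0 := funext fun y => hle (hev y)
  simp [this, pderiv]

theorem ferDeriv_mul {F : SuperFun m n} (hF : IsEven F) (G : SuperFun m n) (j : Fin (2 * n)) :
    ferDeriv j (F * G) = ferDeriv j F * G + F * ferDeriv j G :=
  funext fun x => grDeriv_mul j (hF x) (G x)

theorem superGrad_mul {h g : SuperFun m n} (hh : IsSmooth h) (hg : IsSmooth g) (hhe : IsEven h)
    (hge : IsEven g) (i : GenIdx m n) :
    superGrad (h * g) i = h * superGrad g i + g * superGrad h i := by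
  have hc (a : SuperFun m n) : a * g = g * a := funext fun x => (even_mul_comm (hge x) (a x)).symm
  rcases i with i | i | i
  · change -bosDeriv i (h * g) = h * -bosDeriv i g + g * -bosDeriv i h
    rw [bosDeriv_mul hh hg, hc, mul_neg, mul_neg]
    abel
  · simp only [superGrad]
    rw [ferDeriv_mul hhe, hc, smul_add, mul_smul_comm, mul_smul_comm, add_comm]
  · simp only [superGrad]
    rw [ferDeriv_mul hhe, hc, smul_add, mul_smul_comm, mul_smul_comm, add_comm]

theorem IsSmooth.superGrad {g : SuperFun m n} (hg : IsSmooth g) (i : GenIdx m n) :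
    IsSmooth (superGrad g i) := by
  have hf (c : ℝ) (j : Fin (2 * n)) : IsSmooth (c • ferDeriv j g) :=
    (IsCkOn.smul (c := fun _ => c) contDiffOn_const
      ((hg.isCkOn univ).map (grDeriv j))).isSmooth
  rcases i with i | i | i
  · have := IsCkOn.smul (c := fun _ => -1) contDiffOn_const ((hg.bosDeriv i).isCkOn univ)
    exact (this.congr fun x _ => by simp [SuperSpace.superGrad]).isSmooth
  · exact hf _ _
  · exact hf _ _

theorem superGrad_inl_mem {g : SuperFun m n} (hg : IsSmooth g) (hge : IsEven g) (j : Fin m)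
    (x : Bos m) : superGrad g (Sum.inl j) x ∈ evenGr n :=
  Subalgebra.neg_mem _ (IsEven.bosDeriv hg hge j x)

theorem superGrad_inr_mem {g : SuperFun m n} (hge : IsEven g) (j : Fin n ⊕ Fin n)
    (x : Bos m) : superGrad g (Sum.inr j) x ∈ oddGr n := by
  rcases j with j | j
  · exact Submodule.smul_mem _ _ (grDeriv_mem_odd _ (hge x))
  · exact Submodule.smul_mem _ _ (grDeriv_mem_odd _ (hge x))

/-- The superfunction `-∂_𝐱[g]²`. -/
def gradNegSq (g : SuperFun m n) : SuperFun m n := fun x => negSq fun i => superGrad g i x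

theorem isEven_gradNegSq {g : SuperFun m n} (hg : IsSmooth g) (hge : IsEven g) :
    IsEven (gradNegSq g) := fun x =>
  Subalgebra.sub_mem _
    (Subalgebra.sum_mem _ fun j _ => Subalgebra.mul_mem _ (superGrad_inl_mem hg hge j x)
      (superGrad_inl_mem hg hge j x))
    (Subalgebra.sum_mem _ fun _ _ => odd_mul_odd (superGrad_inr_mem hge _ x)
      (superGrad_inr_mem hge _ x))

theorem IsSmooth.gradNegSq {g : SuperFun m n} (hg : IsSmooth g) : IsSmooth (gradNegSq g) := by
  have h (i) := (hg.superGrad i).isCkOn univ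
  have := (IsCkOn.sum Finset.univ fun (j : Fin m) _ => (h (Sum.inl j)).mul (h (Sum.inl j))).sub
    (IsCkOn.sum Finset.univ fun (j : Fin n) _ =>
      (h (Sum.inr (Sum.inl j))).mul (h (Sum.inr (Sum.inr j))))
  exact (this.congr fun x _ => by simp [SuperSpace.gradNegSq, negSq]).isSmooth

/-- The fermionic components are odd and have no body, so only `|∇g₀|²` remains. Regularity thus
makes the square root available near the surface. -/
theorem body_gradNegSq {g : SuperFun m n} (hg : IsSmooth g) (hge : IsEven g) (x : Bos m) :
    bodyFun (gradNegSq g) x = ∑ j, pderiv j (bodyFun g) x * pderiv j (bodyFun g) x := by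
  have h1 (j : Fin m) : bodyHom n (bosDeriv j g x) = pderiv j (bodyFun g) x :=
    linear_bosDeriv hg (bodyHom n).toLinearMap j x
  have h2 (j : Fin n) : bodyHom n (superGrad g (Sum.inr (Sum.inl j)) x) = 0 :=
    body_odd (superGrad_inr_mem hge _ x)
  simp only [bodyFun, gradNegSq, negSq, body_eq, map_sub, map_sum, map_mul, h2, zero_mul,
    Finset.sum_const_zero, sub_zero]
  simp [superGrad, h1]

theorem body_gradNegSq_pos {g : SuperFun m n} (hg : IsSmooth g) (hge : IsEven g) {x : Bos m}
    (hx : fderiv ℝ (bodyFun g) x ≠ 0) : 0 < bodyFun (gradNegSq g) x := by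
  rw [body_gradNegSq hg hge]
  exact sum_pderiv_sq_pos hx

theorem absGrad_eq (g : SuperFun m n) : absGrad g = fun x => grPow (gradNegSq g x) (1 / 2) := rfl

theorem isCkOn_absGrad {g : SuperFun m n} (hg : IsSmooth g) (hge : IsEven g) {O : Set (Bos m)}
    (hreg : ∀ x ∈ O, fderiv ℝ (bodyFun g) x ≠ 0) : IsCkOn ∞ O (absGrad g) :=
  (hg.gradNegSq.isCkOn O).grPow (fun x hx => body_gradNegSq_pos hg hge (hreg x hx)) _

theorem exists_gradNegSq_mul {h g : SuperFun m n} (hh : IsSmooth h) (hg : IsSmooth g)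
    (hhe : IsEven h) (hge : IsEven g) :
    ∃ W : SuperFun m n, IsSmooth W ∧
      gradNegSq (h * g) = h * h * gradNegSq g + g * W := by
  have s1 (i) := (hg.superGrad i).isCkOn univ
  have s2 (i) := (hh.superGrad i).isCkOn univ
  refine ⟨h * (∑ j : Fin m, (superGrad g (Sum.inl j) * superGrad h (Sum.inl j) +
      superGrad h (Sum.inl j) * superGrad g (Sum.inl j)) -
      ∑ j : Fin n, (superGrad g (Sum.inr (Sum.inl j)) * superGrad h (Sum.inr (Sum.inr j)) +
        superGrad h (Sum.inr (Sum.inl j)) * superGrad g (Sum.inr (Sum.inr j)))) +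
      g * gradNegSq h, ?_, ?_⟩
  · exact (((hh.isCkOn univ).mul ((IsCkOn.sum _ fun j _ => ((s1 _).mul (s2 _)).add
      ((s2 _).mul (s1 _))).sub (IsCkOn.sum _ fun j _ => ((s1 _).mul (s2 _)).add
      ((s2 _).mul (s1 _))))).add ((hg.isCkOn univ).mul (hh.gradNegSq.isCkOn univ))).isSmooth
  · ext x
    have hgc := even_mul_comm (hge x)
    have hhc := even_mul_comm (hhe x)
    -- Gradient components may be odd, so only the even `h` and `g` are moved; the order of `a, b,
    -- c, d` is kept.
    have key (a b c d : Grassmann n) : (h x * a + g x * b) * (h x * c + g x * d) =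
        h x * h x * (a * c) + g x * (h x * (a * d + b * c) + g x * (b * d)) := by
      have e1 : h x * a * (h x * c) = h x * h x * (a * c) := by
        rw [mul_assoc, ← mul_assoc a, ← hhc a]; simp only [mul_assoc]
      have e2 : h x * a * (g x * d) = g x * (h x * (a * d)) := by
        rw [mul_assoc, ← mul_assoc a, ← hgc a, mul_assoc, ← mul_assoc, ← hgc, mul_assoc]
      have e3 : g x * b * (h x * c) = g x * (h x * (b * c)) := by
        rw [mul_assoc, ← mul_assoc b, ← hhc b, mul_assoc]
      have e4 : g x * b * (g x * d) = g x * (g x * (b * d)) := by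
        rw [mul_assoc, ← mul_assoc b, ← hgc b, mul_assoc]
      rw [add_mul, mul_add, mul_add, e1, e2, e3, e4, mul_add, mul_add, mul_add]
      abel
    simp only [gradNegSq, negSq, superGrad_mul hh hg hhe hge, Pi.add_apply, Pi.mul_apply, key,
      Finset.sum_add_distrib, ← Finset.mul_sum, Pi.sub_apply, Finset.sum_apply, mul_add, mul_sub]
    abel

end

end SuperSpace

namespace SuperSpace

open Set Filter

noncomputable section

variable {m n : ℕ}

/-! ### The superdistribution `δ(g)` on superfunctions supported in the regular set -/

/-- The Berezin integral as a linear functional. -/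
def berezinLin (n : ℕ) : Grassmann n →ₗ[ℝ] ℝ :=
  (Real.pi ^ n)⁻¹ • (bodyHom n).toLinearMap ∘ₗ
    (List.finRange (2 * n)).foldl (fun T j => grDeriv j ∘ₗ T) LinearMap.id

theorem berezin_eq (a : Grassmann n) : berezin a = berezinLin n a := by
  have h (L : List (Fin (2 * n))) (T : Grassmann n →ₗ[ℝ] Grassmann n) :
      L.foldl (fun b j => grDeriv j b) (T a) = L.foldl (fun T j => grDeriv j ∘ₗ T) T a := by
    induction L generalizing T with
    | nil => rfl
    | cons j L ih => exact ih (grDeriv j ∘ₗ T)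
  have h' := h (List.finRange (2 * n)) LinearMap.id
  rw [LinearMap.id_apply] at h'
  rw [berezin, h']
  rfl

/-- The value of `δ(g)` on superfunctions with compact support in the regular set of `g`. -/
def superDelta (g Q : SuperFun m n) : ℝ :=
  ∑ j ∈ Finset.range (n + 1), deltaD (bodyFun g) j (deltaTerm g Q j)

variable {O : Set (Bos m)} {g h : SuperFun m n}

theorem HasCkSupp.berezin_mul {k : WithTop ℕ∞} (hO : IsOpen O) {Q a : SuperFun m n}
    (hQ : HasCkSupp k O Q) (ha : IsCkOn k O a) : IsCkSupp k O (fun x => berezin (a x * Q x)) := by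
  simp only [berezin_eq]
  exact (hQ.mul_left hO ha).linear (berezinLin n)

theorem isCkSupp_deltaTerm {k : ℕ} (hO : IsOpen O) (hg : IsSmooth g) {Q : SuperFun m n}
    (hQ : HasCkSupp k O Q) (j : ℕ) : IsCkSupp k O (deltaTerm g Q j) :=
  hQ.berezin_mul hO (a := fun x => (j.factorial : ℝ)⁻¹ • nil (g x) ^ j) <|
    IsCkOn.smul contDiffOn_const ((((hg.isCkOn O).of_le (natCast_le_infty _)).nil).pow j)

theorem superDelta_add (hO : IsOpen O) (hg : IsSmooth g)
    (hreg : ∀ x ∈ O, fderiv ℝ (bodyFun g) x ≠ 0) {Q Q' : SuperFun m n}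
    (hQ : HasCkSupp n O Q) (hQ' : HasCkSupp n O Q') :
    superDelta g (Q + Q') = superDelta g Q + superDelta g Q' := by
  rw [superDelta, superDelta, superDelta, ← Finset.sum_add_distrib]
  refine Finset.sum_congr rfl fun j hj => ?_
  have hjn : (j : WithTop ℕ∞) ≤ n := mod_cast Nat.lt_succ_iff.1 (Finset.mem_range.1 hj)
  rw [← deltaD_add hg.body hO hreg ((isCkSupp_deltaTerm hO hg hQ j).of_le hjn)
    ((isCkSupp_deltaTerm hO hg hQ' j).of_le hjn)]
  congr 1 with x
  simp [deltaTerm, berezin_eq, mul_add]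

/-- The relation `g δ(g) = 0`. -/
theorem superDelta_mul_self (hO : IsOpen O) (hg : IsSmooth g) (hge : IsEven g)
    (hreg : ∀ x ∈ O, fderiv ℝ (bodyFun g) x ≠ 0) {Q : SuperFun m n} (hQ : HasCkSupp n O Q) :
    superDelta g (g * Q) = 0 := by
  have hτ := isCkSupp_deltaTerm hO hg hQ
  -- Splitting `g = g₀ + 𝐠`, the body stays as a scalar factor and `𝐠` raises the power, with `1/j!
  -- = (j+1)/(j+1)!`.
  have hterm (j : ℕ) : deltaTerm g (g * Q) j =
      fun x => bodyFun g x * deltaTerm g Q j x + ((j : ℝ) + 1) * deltaTerm g Q (j + 1) x := by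
    ext x
    have hfac : (j.factorial : ℝ)⁻¹ = ((j : ℝ) + 1) * ((j + 1).factorial : ℝ)⁻¹ := by
      rw [Nat.factorial_succ]
      push_cast
      field_simp
    have e : ((j.factorial : ℝ)⁻¹ • nil (g x) ^ j) * (g x * Q x) =
        bodyFun g x • (((j.factorial : ℝ)⁻¹ • nil (g x) ^ j) * Q x) +
          ((j : ℝ) + 1) • ((((j + 1).factorial : ℝ)⁻¹ • nil (g x) ^ (j + 1)) * Q x) := by
      have hb : g x * Q x = (algebraMap ℝ _ (body (g x)) + nil (g x)) * Q x := by
        rw [← eq_body_add_nil]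
      rw [hb, add_mul, mul_add, ← Algebra.smul_def, mul_smul_comm, smul_mul_assoc _ (nil (g x) ^ (j + 1)),
        smul_smul, ← hfac, pow_succ, smul_mul_assoc _ _ (nil (g x) * Q x), mul_assoc]
      rfl
    simp only [deltaTerm, Pi.mul_apply, berezin_eq, e, map_add, map_smul, smul_eq_mul]
  -- Written as a difference of consecutive terms, to telescope. At `j = 0` the truncated index `j -
  -- 1` is harmless because of the factor `j`.
  have hstep (j : ℕ) (hj : j ∈ Finset.range (n + 1)) :
      deltaD (bodyFun g) j (deltaTerm g (g * Q) j) =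
        ((j + 1 : ℕ) : ℝ) * deltaD (bodyFun g) (j + 1 - 1) (deltaTerm g Q (j + 1)) -
          (j : ℝ) * deltaD (bodyFun g) (j - 1) (deltaTerm g Q j) := by
    have hjn : (j : WithTop ℕ∞) ≤ n := mod_cast Nat.lt_succ_iff.1 (Finset.mem_range.1 hj)
    rw [hterm, deltaD_add hg.body hO hreg
      (((hτ j).of_le hjn).mul_left (hg.body.of_le (natCast_le_infty _)))
      (((hτ (j + 1)).of_le hjn).const_mul _), deltaD_const_mul]
    rcases j with _ | j
    · rw [deltaD_zero_mul_self hg.body hO hreg ((hτ 0).of_le (by simp))]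
      simp
    · rw [deltaD_succ_mul_self hg.body hO hreg ((hτ (j + 1)).of_le hjn)]
      push_cast
      ring
  have hlast : deltaTerm g Q (n + 1) = fun _ => 0 := by
    ext x
    simp [deltaTerm, berezin_eq, pow_eq_zero_of_even (nil_mem_even (hge x)) (body_nil _)
      (Nat.lt_succ_self n)]
  rw [superDelta, Finset.sum_congr rfl hstep, Finset.sum_range_sub
    (fun j => (j : ℝ) * deltaD (bodyFun g) (j - 1) (deltaTerm g Q j)), hlast, deltaD_zero_fun]
  simp

theorem sum_antidiagonal_eq_of_vanish {B : ℕ → ℕ → ℝ} (hB : ∀ k i, n < k + i → B k i = 0) :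
    ∑ j ∈ Finset.range (n + 1), ∑ p ∈ Finset.HasAntidiagonal.antidiagonal j, B p.1 p.2 =
      ∑ k ∈ Finset.range (n + 1), ∑ i ∈ Finset.range (n + 1), B k i := by
  have h1 : ∑ p ∈ Finset.range (n + 1) ×ˢ Finset.range (n + 1), B p.1 p.2 =
      ∑ p ∈ (Finset.range (n + 1) ×ˢ Finset.range (n + 1)).filter fun p => p.1 + p.2 ≤ n,
        B p.1 p.2 :=
    (Finset.sum_filter_of_ne fun p _ hp => not_lt.1 fun h => hp (hB _ _ h)).symm
  rw [← Finset.sum_product', h1, ← Finset.sum_fiberwise_of_maps_to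
    (g := fun p : ℕ × ℕ => p.1 + p.2) (t := Finset.range (n + 1))
    fun p hp => by simp only [Finset.mem_filter, Finset.mem_range] at hp ⊢; omega]
  refine Finset.sum_congr rfl fun j hj => Finset.sum_congr ?_ fun _ _ => rfl
  ext p
  simp only [Finset.HasAntidiagonal.mem_antidiagonal, Finset.mem_filter, Finset.mem_product, Finset.mem_range]
    at hj ⊢
  omega

theorem bodyFun_mul (h g : SuperFun m n) :
    bodyFun (h * g) = fun x => bodyFun h x * bodyFun g x :=
  funext fun x => body_mul (h x) (g x)

/-- The asymmetric split is chosen for `a = h`, `b = g`: powers of the body of `g` are what lowers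
the order of `δ^{(j)}(g₀)`. -/
theorem nil_mul (a b : Grassmann n) : nil (a * b) = a * nil b + body b • nil a := by
  simp only [nil, body_mul, mul_sub, smul_sub]
  rw [← Algebra.commutes (body b) a, ← Algebra.smul_def, mul_comm (body a), map_mul,
    ← Algebra.smul_def (body b)]
  abel

/-- The relation `h δ(h g) = δ(g)`. -/
theorem superDelta_mul_pos (hO : IsOpen O) (hg : IsSmooth g) (hge : IsEven g) (hh : IsSmooth h)
    (hhe : IsEven h) (hpos : ∀ x, 0 < bodyFun h x)
    (hreg : ∀ x ∈ O, fderiv ℝ (bodyFun g) x ≠ 0)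
    (hreg' : ∀ x ∈ O, fderiv ℝ (bodyFun (h * g)) x ≠ 0) {Q : SuperFun m n}
    (hQ : HasCkSupp n O Q) : superDelta (h * g) (h * Q) = superDelta g Q := by
  have hinv (k : ℕ) (l : ℕ) : ContDiff ℝ l (fun x => (bodyFun h x ^ k)⁻¹) :=
    ((hh.body.pow k).inv fun x => (pow_pos (hpos x) k).ne').of_le (natCast_le_infty _)
  have gC (U : Set (Bos m)) : IsCkOn n U fun x => nil (g x) :=
    ((hg.isCkOn U).of_le (natCast_le_infty _)).nil
  have hC (U : Set (Bos m)) : IsCkOn n U fun x => nil (h x) :=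
    ((hh.isCkOn U).of_le (natCast_le_infty _)).nil
  have hC' (U : Set (Bos m)) : IsCkOn n U h := (hh.isCkOn U).of_le (natCast_le_infty _)
  -- Indices: `k` counts factors `𝐠`, `i` factors `𝐡`. Of the power `h^{k+1}`, `k` factors accompany
  -- `𝐠^k` and one comes from `h * Q`; the inverse power of the body prepares the homogeneity
  -- relation of order `k + i`.
  set τ : ℕ → ℕ → Bos m → ℝ := fun k i x => (bodyFun h x ^ (k + i + 1))⁻¹ *
    berezin (nil (g x) ^ k * nil (h x) ^ i * h x ^ (k + 1) * Q x) with hτdef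
  have hτ (k i : ℕ) : IsCkSupp n O (τ k i) :=
    (hQ.berezin_mul hO ((((gC O).pow k).mul ((hC O).pow i)).mul ((hC' O).pow (k + 1)))).mul_left
      (hinv _ _)
  set B : ℕ → ℕ → ℝ := fun k i => (-1) ^ i * ((k + i).choose i : ℝ) * (k.factorial : ℝ)⁻¹ *
    deltaD (bodyFun g) k (τ k i) with hBdef
  have hB (k i : ℕ) (hki : n < k + i) : B k i = 0 := by
    have : τ k i = fun _ => 0 := by
      ext x
      simp [hτdef, pow_mul_pow_eq_zero (nil_mem_even (hge x)) (body_nil _) (nil_mem_even (hhe x))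
        (body_nil _) hki, berezin_eq]
    simp [hBdef, this, deltaD_zero_fun]
  -- In the binomial expansion of `(h𝐠 + g₀𝐡)^j`, homogeneity turns `δ^{(j)}(h₀g₀)` into
  -- `δ^{(j)}(g₀)`, and `g₀^i` then lowers the order to `k = j - i`.
  have hL (j : ℕ) (hj : j ∈ Finset.range (n + 1)) :
      deltaD (bodyFun (h * g)) j (deltaTerm (h * g) (h * Q) j) =
        ∑ p ∈ Finset.HasAntidiagonal.antidiagonal j, B p.1 p.2 := by
    have hjn : (j : WithTop ℕ∞) ≤ n := mod_cast Nat.lt_succ_iff.1 (Finset.mem_range.1 hj)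
    have hterm : deltaTerm (h * g) (h * Q) j = fun x => bodyFun h x ^ (j + 1) *
        ∑ p ∈ Finset.HasAntidiagonal.antidiagonal j, bodyFun g x ^ p.2 *
          ((j.factorial : ℝ)⁻¹ * (j.choose p.1 : ℝ) * τ p.1 p.2 x) := by
      ext x
      have hx := (pow_pos (hpos x) (j + 1)).ne'
      have hcom : Commute (h x * nil (g x)) (body (g x) • nil (h x)) :=
        even_mul_comm (Subalgebra.mul_mem _ (hhe x) (nil_mem_even (hge x))) _
      have e : ((j.factorial : ℝ)⁻¹ • nil (h x * g x) ^ j) * (h x * Q x) =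
          ∑ p ∈ Finset.HasAntidiagonal.antidiagonal j, ((j.factorial : ℝ)⁻¹ * (j.choose p.1 : ℝ) *
            bodyFun g x ^ p.2) • (nil (g x) ^ p.1 * nil (h x) ^ p.2 * h x ^ (p.1 + 1) * Q x) := by
        rw [nil_mul, hcom.add_pow', Finset.smul_sum, Finset.sum_mul]
        refine Finset.sum_congr rfl fun p _ => ?_
        have e1 : (h x * nil (g x)) ^ p.1 = nil (g x) ^ p.1 * h x ^ p.1 := by
          rw [even_mul_comm (hhe x), Commute.mul_pow (even_mul_comm (nil_mem_even (hge x)) _)]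
        have e2 : h x ^ p.1 * nil (h x) ^ p.2 = nil (h x) ^ p.2 * h x ^ p.1 :=
          even_mul_comm (Subalgebra.pow_mem _ (hhe x) _) _
        rw [e1, smul_pow, mul_smul_comm, mul_assoc (nil (g x) ^ p.1), e2, ← Nat.cast_smul_eq_nsmul ℝ,
          smul_smul, smul_smul, smul_mul_assoc, pow_succ]
        simp only [mul_assoc]
        rfl
      simp only [deltaTerm, Pi.mul_apply, e, berezin_eq, map_sum, map_smul, smul_eq_mul,
        Finset.mul_sum, hτdef]
      refine Finset.sum_congr rfl fun p hp => ?_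
      rw [Finset.HasAntidiagonal.mem_antidiagonal.1 hp]
      field_simp
    have hsum (p : ℕ × ℕ) (_ : p ∈ Finset.HasAntidiagonal.antidiagonal j) : IsCkSupp j O fun x =>
        bodyFun g x ^ p.2 * ((j.factorial : ℝ)⁻¹ * (j.choose p.1 : ℝ) * τ p.1 p.2 x) :=
      (((hτ p.1 p.2).of_le hjn).const_mul _).mul_left ((hg.body.pow _).of_le (natCast_le_infty _))
    rw [hterm, bodyFun_mul, deltaD_mul_pos hg.body hh.body hpos hO hreg
      (by rwa [bodyFun_mul] at hreg') (IsCkSupp.sum _ hsum), deltaD_sum hg.body hO hreg _ hsum]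
    refine Finset.sum_congr rfl fun p hp => ?_
    obtain ⟨k, i⟩ := p
    obtain rfl : k + i = j := Finset.HasAntidiagonal.mem_antidiagonal.1 hp
    have hcm := ((hτ k i).of_le hjn).const_mul (((k + i).factorial : ℝ)⁻¹ * ((k + i).choose k : ℝ))
    simp only []
    rw [deltaD_add_pow_mul hg.body hO hreg hcm, deltaD_const_mul, Nat.choose_symm_add]
    simp only [hBdef]
    have := Nat.factorial_ne_zero (k + i)
    field_simp
  -- Inserting `1 = h^{-(k+1)} h^{k+1}` and expanding the negative power in `𝐡` produces the same `B
  -- k i`.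
  have hR (k : ℕ) (hk : k ∈ Finset.range (n + 1)) :
      deltaD (bodyFun g) k (deltaTerm g Q k) = ∑ i ∈ Finset.range (n + 1), B k i := by
    have hkn : (k : WithTop ℕ∞) ≤ n := mod_cast Nat.lt_succ_iff.1 (Finset.mem_range.1 hk)
    have hterm : deltaTerm g Q k = fun x => ∑ i ∈ Finset.range (n + 1),
        ((-1) ^ i * ((k + i).choose i : ℝ) * (k.factorial : ℝ)⁻¹) * τ k i x := by
      ext x
      have h1 : (1 : Grassmann n) = grPow (h x) (-((k : ℝ) + 1)) * h x ^ (k + 1) := by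
        rw [← grPow_natCast (hhe x) (hpos x), Nat.cast_succ, grPow_neg_mul (hhe x) (hpos x)]
      have e : ((k.factorial : ℝ)⁻¹ • nil (g x) ^ k) * Q x = ∑ i ∈ Finset.range (n + 1),
          ((-1) ^ i * ((k + i).choose i : ℝ) * (k.factorial : ℝ)⁻¹ *
            (bodyFun h x ^ (k + i + 1))⁻¹) •
              (nil (g x) ^ k * nil (h x) ^ i * h x ^ (k + 1) * Q x) := by
        conv_lhs => rw [← one_mul (Q x), h1, grPow_neg_succ, Finset.sum_mul, Finset.sum_mul,
          Finset.mul_sum]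
        refine Finset.sum_congr rfl fun i _ => ?_
        have hp : body (h x) ^ (-((k : ℝ) + 1) - i) = (bodyFun h x ^ (k + i + 1))⁻¹ := by
          rw [← Real.rpow_natCast, ← Real.rpow_neg (hpos x).le, bodyFun]
          congr 1
          push_cast
          ring
        rw [hp]
        simp only [smul_mul_assoc, mul_smul_comm, smul_smul, mul_assoc]
        congr 1
        ring
      simp only [deltaTerm, e, berezin_eq, map_sum, map_smul, smul_eq_mul, hτdef, mul_assoc]
    rw [hterm, deltaD_sum hg.body hO hreg _ fun i _ => ((hτ k i).of_le hkn).const_mul _]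
    exact Finset.sum_congr rfl fun i _ => deltaD_const_mul k _ _
  rw [superDelta, superDelta, Finset.sum_congr rfl hL, Finset.sum_congr rfl hR]
  exact sum_antidiagonal_eq_of_vanish hB

end

end SuperSpace

namespace SuperSpace

open Set Filter

noncomputable section

variable {m n : ℕ} {O : Set (Bos m)} {g h : SuperFun m n}

/-! ### Independence of the defining phase function -/

/-- Since `g = (hg) h⁻¹`, a multiple of `g` is a multiple of `hg`, which `δ(hg)` annihilates. -/
theorem superDelta_mul_mul_self (hO : IsOpen O) (hg : IsSmooth g) (hge : IsEven g) (hh : IsSmooth h)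
    (hhe : IsEven h) (hpos : ∀ x, 0 < bodyFun h x)
    (hreg' : ∀ x ∈ O, fderiv ℝ (bodyFun (h * g)) x ≠ 0) {Q : SuperFun m n}
    (hQ : HasCkSupp n O Q) : superDelta (h * g) (g * Q) = 0 := by
  have hi : IsCkOn n O fun x => grPow (h x) (-1) :=
    ((hh.isCkOn O).of_le (natCast_le_infty _)).grPow (fun x _ => hpos x) _
  have e : g * Q = (h * g) * ((fun x => grPow (h x) (-1)) * Q) := by
    ext x
    have h1 : h x * grPow (h x) (-1) = 1 := by
      have := grPow_neg_mul (hhe x) (hpos x) 1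
      rwa [grPow_one (hhe x) (hpos x), ← even_mul_comm (hhe x)] at this
    simp only [Pi.mul_apply]
    rw [even_mul_comm (hhe x), mul_assoc, ← mul_assoc (h x), h1, one_mul]
  rw [e]
  exact superDelta_mul_self hO (hh.mul hg) (hhe.mul hge) hreg' (hQ.mul_left hO hi)

/-- If `A = h B + g R` on `O`, then `δ(h g) A = δ(g) B`. -/
theorem superDelta_eq_of_eqOn (hO : IsOpen O) (hg : IsSmooth g) (hge : IsEven g) (hh : IsSmooth h)
    (hhe : IsEven h) (hpos : ∀ x, 0 < bodyFun h x) (hreg : ∀ x ∈ O, fderiv ℝ (bodyFun g) x ≠ 0)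
    (hreg' : ∀ x ∈ O, fderiv ℝ (bodyFun (h * g)) x ≠ 0) {Q A B R : SuperFun m n}
    (hQ : HasCkSupp n O Q) (hB : IsCkOn n O B) (hR : IsCkOn n O R)
    (hA : ∀ x ∈ O, A x = h x * B x + g x * R x) :
    superDelta (h * g) (A * Q) = superDelta g (B * Q) := by
  have hs {k : SuperFun m n} (hk : IsSmooth k) : IsCkOn n O k :=
    (hk.isCkOn O).of_le (natCast_le_infty _)
  have hBQ := hQ.mul_left hO hB
  have hRQ := hQ.mul_left hO hR
  have e : A * Q = h * (B * Q) + g * (R * Q) := by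
    ext x
    by_cases hx : x ∈ O
    · simp [hA x hx, add_mul, mul_assoc]
    · have : Q x = 0 := (monomialBasis n).ext_elem fun C => by
        have : coeff C Q x = 0 :=
          image_eq_zero_of_notMem_tsupport fun h => hx ((hQ C).tsupport_subset h)
        simpa [coeff] using this
      simp [this]
  rw [e, superDelta_add hO (hh.mul hg) hreg' (hBQ.mul_left hO (hs hh)) (hRQ.mul_left hO (hs hg)),
    superDelta_mul_pos hO hg hge hh hhe hpos hreg hreg' hBQ,
    superDelta_mul_mul_self hO hg hge hh hhe hpos hreg' hRQ, add_zero]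

theorem superDelta_superGrad (hO : IsOpen O) (hg : IsSmooth g) (hge : IsEven g) (hh : IsSmooth h)
    (hhe : IsEven h) (hpos : ∀ x, 0 < bodyFun h x) (hreg : ∀ x ∈ O, fderiv ℝ (bodyFun g) x ≠ 0)
    (hreg' : ∀ x ∈ O, fderiv ℝ (bodyFun (h * g)) x ≠ 0) {Q : SuperFun m n}
    (hQ : HasCkSupp n O Q) (i : GenIdx m n) :
    superDelta (h * g) (superGrad (h * g) i * Q) = superDelta g (superGrad g i * Q) := by
  refine superDelta_eq_of_eqOn hO hg hge hh hhe hpos hreg hreg' hQ (R := superGrad h i)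
    (((hg.superGrad i).isCkOn O).of_le (natCast_le_infty _))
    (((hh.superGrad i).isCkOn O).of_le (natCast_le_infty _)) fun x _ => ?_
  rw [superGrad_mul hh hg hhe hge]
  rfl

/-- With `S` the sum of `|∂[hg]|` and `h|∂[g]|`, their difference times `S` is the difference of
squares `gW`. On `O` the body of `S` is positive, so `R = W S⁻¹`. -/
theorem exists_absGrad_mul (hg : IsSmooth g) (hge : IsEven g) (hh : IsSmooth h)
    (hhe : IsEven h) (hpos : ∀ x, 0 < bodyFun h x) (hreg : ∀ x ∈ O, fderiv ℝ (bodyFun g) x ≠ 0)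
    (hreg' : ∀ x ∈ O, fderiv ℝ (bodyFun (h * g)) x ≠ 0) :
    ∃ R : SuperFun m n, IsCkOn ∞ O R ∧
      ∀ x ∈ O, absGrad (h * g) x = h x * absGrad g x + g x * R x := by
  obtain ⟨W, hW, hWeq⟩ := exists_gradNegSq_mul hh hg hhe hge
  have hg' := hh.mul hg
  have hge' := hhe.mul hge
  have evA (x) : absGrad (h * g) x ∈ evenGr n := grPow_mem_even (isEven_gradNegSq hg' hge' x) _
  have evB (x) : absGrad g x ∈ evenGr n := grPow_mem_even (isEven_gradNegSq hg hge x) _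
  set S : SuperFun m n := absGrad (h * g) + h * absGrad g
  have evS (x) : S x ∈ evenGr n := Subalgebra.add_mem _ (evA x) (Subalgebra.mul_mem _ (hhe x) (evB x))
  have hSpos : ∀ x ∈ O, 0 < bodyFun S x := by
    intro x hx
    have h1 : bodyFun S x = bodyFun (gradNegSq (h * g)) x ^ (1 / 2 : ℝ) +
        bodyFun h x * bodyFun (gradNegSq g) x ^ (1 / 2 : ℝ) := by
      rw [show bodyFun S x = body (absGrad (h * g) x) + body (h x * absGrad g x) from
        map_add (bodyHom n) _ _, body_mul, absGrad_eq, absGrad_eq, body_grPow, body_grPow]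
      rfl
    rw [h1]
    exact add_pos (Real.rpow_pos_of_pos (body_gradNegSq_pos hg' hge' (hreg' x hx)) _)
      (mul_pos (hpos x) (Real.rpow_pos_of_pos (body_gradNegSq_pos hg hge (hreg x hx)) _))
  refine ⟨W * fun x => grPow (S x) (-1), (hW.isCkOn O).mul (IsCkOn.grPow ?_ hSpos _), ?_⟩
  · exact (isCkOn_absGrad hg' hge' hreg').add ((hh.isCkOn O).mul (isCkOn_absGrad hg hge hreg))
  · intro x hx
    have hA : absGrad (h * g) x * absGrad (h * g) x = gradNegSq (h * g) x :=
      grPow_half_mul_self (isEven_gradNegSq hg' hge' x) (body_gradNegSq_pos hg' hge' (hreg' x hx))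
    have hB : absGrad g x * absGrad g x = gradNegSq g x :=
      grPow_half_mul_self (isEven_gradNegSq hg hge x) (body_gradNegSq_pos hg hge (hreg x hx))
    have hS : S x * grPow (S x) (-1) = 1 := by
      have := grPow_neg_mul (evS x) (hSpos x hx) 1
      rwa [grPow_one (evS x) (hSpos x hx), ← even_mul_comm (evS x)] at this
    have hfac : (absGrad (h * g) x - h x * absGrad g x) * S x = g x * W x := by
      have e1 : h x * absGrad g x * (h x * absGrad g x) = h x * h x * gradNegSq g x := by
        rw [mul_assoc, ← mul_assoc (absGrad g x), ← even_mul_comm (hhe x) (absGrad g x), mul_assoc,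
          hB, mul_assoc]
      have e2 : S x = absGrad (h * g) x + h x * absGrad g x := rfl
      rw [e2, sub_mul, mul_add, mul_add, hA, e1, even_mul_comm (evA x) (h x * absGrad g x), hWeq]
      simp only [Pi.add_apply, Pi.mul_apply]
      abel
    have h2 : absGrad (h * g) x - h x * absGrad g x = g x * (W x * grPow (S x) (-1)) := by
      rw [← mul_assoc, ← hfac, mul_assoc, hS, mul_one]
    rw [Pi.mul_apply, ← h2]
    abel

theorem superDelta_absGrad (hO : IsOpen O) (hg : IsSmooth g) (hge : IsEven g) (hh : IsSmooth h)
    (hhe : IsEven h) (hpos : ∀ x, 0 < bodyFun h x) (hreg : ∀ x ∈ O, fderiv ℝ (bodyFun g) x ≠ 0)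
    (hreg' : ∀ x ∈ O, fderiv ℝ (bodyFun (h * g)) x ≠ 0) {Q : SuperFun m n}
    (hQ : HasCkSupp n O Q) :
    superDelta (h * g) (absGrad (h * g) * Q) = superDelta g (absGrad g * Q) := by
  obtain ⟨R, hR, h1⟩ := exists_absGrad_mul hg hge hh hhe hpos hreg hreg'
  exact superDelta_eq_of_eqOn hO hg hge hh hhe hpos hreg hreg' hQ
    ((isCkOn_absGrad hg hge hreg).of_le (natCast_le_infty _)) (hR.of_le (natCast_le_infty _)) h1

/-- Localisation of `∫ δ(g) G F` near the part of the surface on which `F` lives. -/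
theorem deltaIntegral_eq_superDelta (hO : IsOpen O) (hg : IsSmooth g)
    (hreg : ∀ x ∈ O, fderiv ℝ (bodyFun g) x ≠ 0) {χ : Bos m → ℝ} (hχ : HasCompactSupport χ)
    {F G : SuperFun m n} (hF : HasCkSupp n O fun x => χ x • F x) (hG : IsCkOn n O G)
    (h1 : ∀ x ∈ zeroSet g, x ∈ tsupport F → ∀ᶠ y in 𝓝 x, χ y = 1) :
    DeltaIntegrable g (G * F) ∧
      deltaIntegral g (G * F) = superDelta g (G * fun x => χ x • F x) := by
  have key (j : ℕ) (hj : j ∈ Finset.range (n + 1)) : HasDeltaPairing (bodyFun g) j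
      (deltaTerm g (G * F) j) (deltaD (bodyFun g) j (deltaTerm g (G * fun x => χ x • F x) j)) := by
    have hjn : (j : WithTop ℕ∞) ≤ n := mod_cast Nat.lt_succ_iff.1 (Finset.mem_range.1 hj)
    have e : deltaTerm g (G * fun x => χ x • F x) j = fun x => χ x * deltaTerm g (G * F) j x := by
      ext x
      simp [deltaTerm, berezin_eq]
    have hs : tsupport (deltaTerm g (G * F) j) ⊆ tsupport F := by
      refine closure_mono fun x hx h0 => hx ?_
      simp [deltaTerm, berezin_eq, h0]
    have hck := (isCkSupp_deltaTerm hO hg (hF.mul_left hO hG) j).of_le hjn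
    rw [e] at hck ⊢
    exact hasDeltaPairing_of_bump hg.body hO hreg hχ hck fun x hx hxF => h1 x hx (hs hxF)
  exact ⟨fun j hj => ⟨_, key j hj⟩,
    Finset.sum_congr rfl fun j hj => (key j hj).deltaPairing_eq⟩

theorem zeroSet_mul (hpos : ∀ x, 0 < bodyFun h x) : zeroSet (h * g) = zeroSet g := by
  ext x
  simp [zeroSet, bodyFun_mul, (hpos x).ne']

/-- The superdistributions `δ(g) ∂_𝐱[g]` and `δ(g) |∂_𝐱[g]|` do not change if `g` is multiplied by
an even superfunction with positive body. -/
theorem surface_mul_pos (hg : IsSmooth g) (hge : IsEven g) (hgr : IsRegular g) (hh : IsSmooth h)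
    (hhe : IsEven h) (hpos : ∀ x, 0 < bodyFun h x) {F : SuperFun m n}
    (hF : IsCkNear n (zeroSet g) F) (hK : IsCompact (zeroSet g ∩ tsupport F)) :
    SurfaceIntegrable (h * g) F ∧ SurfaceIntegrable g F ∧
      (∀ i, deltaIntegral (h * g) (superGrad (h * g) i * F) =
        deltaIntegral g (superGrad g i * F)) ∧
      deltaIntegral (h * g) (absGrad (h * g) * F) = deltaIntegral g (absGrad g * F) := by
  obtain ⟨U, hU, hZU, hFU⟩ := hF
  have hg' := hh.mul hg
  have hge' := hhe.mul hge
  -- On the zero set `∇(h₀g₀) = h₀∇g₀`.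
  have hgr' : IsRegular (h * g) := by
    intro x hx
    rw [zeroSet_mul hpos] at hx
    have h0 : bodyFun g x = 0 := hx
    rw [bodyFun_mul, fderiv_fun_mul (hh.body.differentiable (by simp) x)
      (hg.body.differentiable (by simp) x), h0, zero_smul, add_zero]
    exact smul_ne_zero (hpos x).ne' (hgr x hx)
  have hopen {f : Bos m → ℝ} (hf : ContDiff ℝ ∞ f) : IsOpen {x | fderiv ℝ f x ≠ 0} :=
    isOpen_ne_fun (hf.continuous_fderiv (by simp)) continuous_const
  -- One open set on which `F` is `C^n` and both phase functions are regular; it contains the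
  -- compact set where surface and support meet, so a single cutoff serves both sides.
  set O : Set (Bos m) := U ∩ ({x | fderiv ℝ (bodyFun g) x ≠ 0} ∩
    {x | fderiv ℝ (bodyFun (h * g)) x ≠ 0})
  have hO : IsOpen O := hU.inter ((hopen hg.body).inter (hopen hg'.body))
  have hreg : ∀ x ∈ O, fderiv ℝ (bodyFun g) x ≠ 0 := fun x hx => hx.2.1
  have hreg' : ∀ x ∈ O, fderiv ℝ (bodyFun (h * g)) x ≠ 0 := fun x hx => hx.2.2
  obtain ⟨χ, hχ, hχ1, -⟩ := exists_bump hK hO fun x hx =>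
    ⟨hZU hx.1, hgr x hx.1, hgr' x (by rw [zeroSet_mul hpos]; exact hx.1)⟩
  have h1 : ∀ x ∈ zeroSet g, x ∈ tsupport F → ∀ᶠ y in 𝓝 x, χ y = 1 := fun x hx hxF =>
    hχ1.filter_mono (nhds_le_nhdsSet (show x ∈ zeroSet g ∩ tsupport F from ⟨hx, hxF⟩))
  have hQ : HasCkSupp n O fun x => χ x • F x := fun A => by
    have := (hχ.of_le (natCast_le_infty n)).mul_contDiffOn hO
      ((hFU A).mono inter_subset_left)
    have e : coeff A (fun x => χ x • F x) = fun x => coeff A F x * χ x := by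
      ext x
      simp [coeff, mul_comm]
    rw [e]
    exact this
  have key {f G : SuperFun m n} (hf : IsSmooth f) (hfr : ∀ x ∈ O, fderiv ℝ (bodyFun f) x ≠ 0)
      (hz : zeroSet f = zeroSet g) (hG : IsCkOn ∞ O G) :=
    deltaIntegral_eq_superDelta hO hf hfr hχ.hasCompactSupport hQ
      (hG.of_le (natCast_le_infty _)) (hz ▸ h1)
  have k1 (i) := key hg hreg rfl ((hg.superGrad i).isCkOn O)
  have k2 (i) := key hg' hreg' (zeroSet_mul hpos) ((hg'.superGrad i).isCkOn O)
  have k3 := key hg hreg rfl (isCkOn_absGrad hg hge hreg)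
  have k4 := key hg' hreg' (zeroSet_mul hpos) (isCkOn_absGrad hg' hge' hreg')
  refine ⟨⟨k4.1, fun i => (k2 i).1⟩, ⟨k3.1, fun i => (k1 i).1⟩, fun i => ?_, ?_⟩
  · rw [(k1 i).2, (k2 i).2, superDelta_superGrad hO hg hge hh hhe hpos hreg hreg' hQ]
  · rw [k3.2, k4.2, superDelta_absGrad hO hg hge hh hhe hpos hreg hreg' hQ]

theorem IsTest.isCkNear {F : SuperFun m n} (hF : IsTest F) (k : ℕ) (S : Set (Bos m)) :
    IsCkNear k S F :=
  ⟨univ, isOpen_univ, subset_univ S, (hF.1.isCkOn univ).of_le (natCast_le_infty k)⟩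

theorem isClosed_zeroSet (hg : IsSmooth g) : IsClosed (zeroSet g) :=
  isClosed_eq hg.body.continuous continuous_const

end

end SuperSpace



theorem mainTheorem4 (m n : ℕ) (g h : SuperSpace.SuperFun m n)
    (hg_smooth : SuperSpace.IsSmooth g) (hg_even : SuperSpace.IsEven g)
    (hh_smooth : SuperSpace.IsSmooth h) (hh_even : SuperSpace.IsEven h)
    (hg_reg : SuperSpace.IsRegular g) (hh_pos : ∀ x, 0 < SuperSpace.bodyFun h x) :
    (∀ F : SuperSpace.SuperFun m n, SuperSpace.IsTest F → ∀ i : SuperSpace.GenIdx m n,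
      SuperSpace.DeltaIntegrable (h * g) (SuperSpace.superGrad (h * g) i * F) ∧
      SuperSpace.DeltaIntegrable g (SuperSpace.superGrad g i * F) ∧
      SuperSpace.deltaIntegral (h * g) (SuperSpace.superGrad (h * g) i * F) =
        SuperSpace.deltaIntegral g (SuperSpace.superGrad g i * F)) ∧
    (∀ F : SuperSpace.SuperFun m n, SuperSpace.IsTest F →
      SuperSpace.DeltaIntegrable (h * g) (SuperSpace.absGrad (h * g) * F) ∧
      SuperSpace.DeltaIntegrable g (SuperSpace.absGrad g * F) ∧
      SuperSpace.deltaIntegral (h * g) (SuperSpace.absGrad (h * g) * F) =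
        SuperSpace.deltaIntegral g (SuperSpace.absGrad g * F)) ∧
    (∀ φ : SuperSpace.SuperFun m n, SuperSpace.DefineSameSurface g φ →
      IsCompact (SuperSpace.zeroSet g) →
      SuperSpace.zeroSet φ = SuperSpace.zeroSet g ∧
      ∀ F : SuperSpace.SuperFun m n, SuperSpace.IsCkNear n (SuperSpace.zeroSet g) F →
        SuperSpace.SurfaceIntegrable φ F ∧ SuperSpace.SurfaceIntegrable g F ∧
        SuperSpace.orientedSurfaceIntegral φ F = SuperSpace.orientedSurfaceIntegral g F ∧
        SuperSpace.surfaceIntegral φ F = SuperSpace.surfaceIntegral g F) := by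
  have hZ := SuperSpace.isClosed_zeroSet hg_smooth
  have test (F : SuperSpace.SuperFun m n) (hF : SuperSpace.IsTest F) :=
    SuperSpace.surface_mul_pos hg_smooth hg_even hg_reg hh_smooth hh_even hh_pos (hF.isCkNear n _)
      (hF.2.isCompact.inter_left hZ)
  refine ⟨fun F hF i => ?_, fun F hF => ?_, fun φ hφ hK => ?_⟩
  · obtain ⟨h1, h2, h3, -⟩ := test F hF
    exact ⟨h1.2 i, h2.2 i, h3 i⟩
  · obtain ⟨h1, h2, -, h4⟩ := test F hF
    exact ⟨h1.1, h2.1, h4⟩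
  -- The factor `k` relating `φ` to `g` now plays the role of `h`; compactness comes from the
  -- surface instead of the support of `F`.
  · obtain ⟨-, -, -, -, -, -, k, hk, hke, hkpos, rfl⟩ := hφ
    refine ⟨SuperSpace.zeroSet_mul hkpos, fun F hF => ?_⟩
    obtain ⟨h1, h2, h3, h4⟩ := SuperSpace.surface_mul_pos hg_smooth hg_even hg_reg hk hke hkpos hF
      (hK.inter_right (isClosed_tsupport F))
    exact ⟨h1, h2, by simp only [SuperSpace.orientedSurfaceIntegral, h3], h4⟩
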